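/- **Setting.** Let $\mathcal A$ be a finite set of $k$ actions with reward distributions $P_a$ on $\mathbb R$ ($a\in\mathcal A$), means $\mu_a$, and gaps $\Delta_a=\max_b\mu_b-\mu_a$. Let $G$ be a connected undirected graph on the agents $V=\{1,\dots,m\}$, with graph distance $d_{vw}$. In every round $t=1,\dots,n$ each agent $w$ plays an action $A^w_t$ and observes a reward $X^w_t\sim P_{A^w_t}$; given the actions, rewards are independent over rounds and agents. Let $T_{aw}(n)$ be the number of rounds $t\le n$ with $A_t^w=a$; the group regret is $R_G(n)=\sum_a\Delta_a\,\mathbb E\big[\sum_{w}T_{aw}(n)\big]$. **Single-agent algorithm.** Let $\epsilon\in(0,1]$ and $\sigma$ be given. The truncated-mean robust upper confidence bound algorithm $\pi$ selects in its round $t$ an action $a$ maximising (ties broken by any measurable rule) the index $$B_a=\frac1s\sum_{i=1}^{s}x_i\,\mathbf 1\Big\{|x_i|\le\Big(\frac{\sigma i}{\ln t^2}\Big)^{\frac1{1+\epsilon}}\Big\}+4\,\sigma^{\frac1{1+\epsilon}}\Big(\frac{\ln t^2}{s}\Big)^{\frac{\epsilon}{1+\epsilon}},$$ where $x_1,\dots,x_s$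 are the rewards of $a$ fed to $\pi$ so far, in order; $B_a=+\infty$ if $s=0$. **QuACK with leader $v\in V$.** The leader keeps a first-in first-out queue of rewards for each action, initially empty. In round $t$ the leader first receives from each $w\ne v$ with $t>d_{vw}$ the pair $(A^w_{t-d_{vw}},X^w_{t-d_{vw}})$ and appends the reward to the queue of that action. As long as the action selected by $\pi$ has a non-empty queue, the first reward is removed from that queue and fed to $\pi$, which then selects again. Once $\pi$ selects an action with empty queue, the leader plays it and feeds the observed reward to $\pi$. Each agent $w\neq v$ plays $A^w_t=A^v_{t-d_{vw}}$ if $t>d_{vw}$, and an independent uniformly random action otherwise. **Statement.** For every $\epsilon\in(0,1]$ there is a constant $C>0$ depending only on $\epsilon$ such that the following holds for all $m,n$ with $mn\ge 2$, all connected $G$, all leaders $v\in V$, all $k$, all $\sigma$ and all reward distributions with $\mathbb E_{X\sim P_a}|X|^{1+\epsilon}\le\sigma$ for every $a\in\mathcal A$. Running QuACK with leader $v$ and the truncated-mean robust upper confidence bound algorithm with parameters $\epsilon,\sigma$ guarantees $$R_G(n)\le C\left(\sum_{a:\Delta_a>0}\frac{\sigma^{1/\epsilon}\ln(mn)}{\Delta_a^{1/\epsilon}}+\Big(\sum_{w=1}^m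 d_{vw}\Big)\sum_{a:\Delta_a>0}\Delta_a\right).$$ -/

import Mathlib

open MeasureTheory ProbabilityTheory

noncomputable section

namespace Quack

/-! ### Reward distributions -/

/-- Mean reward `μ_a` of action `a`. -/
def mean {k : ℕ} (ν : Fin k → Measure ℝ) (a : Fin k) : ℝ := ∫ x, x ∂(ν a)

/-- Sub-optimality gap `Δ_a = max_b μ_b - μ_a`. -/
def gap {k : ℕ} (ν : Fin k → Measure ℝ) (a : Fin k) : ℝ := (⨆ b, mean ν b) - mean ν a

/-- The sub-optimal actions. -/
def subopt {k : ℕ} (ν : Fin k → Measure ℝ) : Finset (Fin k) :=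
  open Classical in Finset.univ.filter fun a => 0 < gap ν a

/-! ### The truncated-mean robust upper confidence bound algorithm

A single-agent history is the chronological list of the (action, reward) pairs seen so far, and a
single-agent bandit algorithm maps each history to the next action. -/

/-- The rewards of action `a` in a history, in chronological order. -/
def samples {k : ℕ} (h : List (Fin k × ℝ)) (a : Fin k) : List ℝ :=
  h.filterMap fun p => if p.1 = a then some p.2 else none

/-- Truncated empirical mean at confidence level `δ`: the `i`-th sample (`i = 1, 2, …`) is kept if
its absolute value is at most `(σ i / ln (1/δ)) ^ (1/(1+ε))` and replaced by `0` otherwise. -/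
def truncatedMean (ε σ δ : ℝ) (xs : List ℝ) : ℝ :=
  (∑ i : Fin xs.length,
    if |xs[i]| ≤ (σ * ((i : ℕ) + 1 : ℝ) / Real.log (1 / δ)) ^ (1 / (1 + ε)) then xs[i] else 0)
      / xs.length

/-- Index of action `a` in round `t = h.length + 1`, with `δ = t⁻²`. It is `+∞` for an action without
samples; an action that has samples is only evaluated at some `t ≥ 2`. -/
def robustIndex {k : ℕ} (ε σ : ℝ) (h : List (Fin k × ℝ)) (a : Fin k) : EReal :=
  let xs := samples h a
  let t : ℝ := (h.length : ℝ) + 1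
  if xs.length = 0 then ⊤
  else ((truncatedMean ε σ (1 / t ^ 2) xs
    + 4 * σ ^ (1 / (1 + ε)) * (Real.log (t ^ 2) / xs.length) ^ (ε / (1 + ε)) : ℝ) : EReal)

/-- `π` is a truncated-mean robust UCB algorithm: it always selects an action of maximal index.
Ties may be broken in any way. -/
def IsRobustUCB {k : ℕ} (ε σ : ℝ) (π : List (Fin k × ℝ) → Fin k) : Prop :=
  ∀ h a, robustIndex ε σ h a ≤ robustIndex ε σ h (π h)

/-- Each choice is a measurable function of the past actions and rewards. -/
def MeasurablePolicy {k : ℕ} (π : List (Fin k × ℝ) → Fin k) : Prop :=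
  ∀ s : ℕ, Measurable fun h : Fin s → Fin k × ℝ => π (List.ofFn h)

/-! ### QuACK -/

/-- One pass of the leader's loop, on a pair (history of `π`, queues): if the queue of the action
selected by `π` is non-empty, its first reward is removed and fed to `π`. -/
def serve {k : ℕ} (π : List (Fin k × ℝ) → Fin k)
    (s : List (Fin k × ℝ) × (Fin k → List ℝ)) : List (Fin k × ℝ) × (Fin k → List ℝ) :=
  match s.2 (π s.1) with
  | [] => s
  | x :: xs => (s.1 ++ [(π s.1, x)], Function.update s.2 (π s.1) xs)

/-- Total number of queued rewards. -/
def queued {k : ℕ} (Q : Fin k → List ℝ) : ℕ := ∑ a, (Q a).length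

/-- The leader's loop, run until the selected action has an empty queue; as each effective pass
removes one reward, `queued` passes suffice (see `drain_empty`). -/
def drain {k : ℕ} (π : List (Fin k × ℝ) → Fin k)
    (s : List (Fin k × ℝ) × (Fin k → List ℝ)) : List (Fin k × ℝ) × (Fin k → List ℝ) :=
  (serve π)^[queued s.2] s

/-- State of the network between two rounds. -/
structure State (m k : ℕ) where
  /-- Actions and rewards of all agents in the completed rounds, most recent round first. -/
  log : List (Fin m → Fin k × ℝ)
  /-- Everything fed so far to the leader's single-agent algorithm, in chronological order. -/
  hist : List (Fin k × ℝ)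
  /-- The leader's queues, first-in first-out. -/
  queue : Fin k → List ℝ

/-- The state before the first round. -/
def State.init (m k : ℕ) : State m k := ⟨[], [], fun _ => []⟩

/-- What happened at all agents `d ≥ 1` rounds before the current one, if there was such a round. -/
def State.ago {m k : ℕ} (S : State m k) (d : ℕ) : Option (Fin m → Fin k × ℝ) := S.log[d - 1]?

/-- Messages that reach the leader `v` in the current round: from each follower `w`, the action and
reward of `w` from `d_{vw}` rounds ago. -/
def inbox {m k : ℕ} (G : SimpleGraph (Fin m)) (v : Fin m) (S : State m k) : List (Fin k × ℝ) :=
  (List.finRange m).filterMap fun w =>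
    if w = v then none else (S.ago (G.dist v w)).map fun r => r w

/-- One round of QuACK with leader `v`. Here `x w a` is the reward that agent `w` obtains in this
round if it plays `a`, and `u w` is the exploratory action of agent `w` in this round. -/
def step {m k : ℕ} (G : SimpleGraph (Fin m)) (v : Fin m) (π : List (Fin k × ℝ) → Fin k)
    (x : Fin m → Fin k → ℝ) (u : Fin m → Fin k) (S : State m k) : State m k :=
  let Q : Fin k → List ℝ := fun a => S.queue a ++ samples (inbox G v S) a
  let L := drain π (S.hist, Q)
  let act : Fin m → Fin k := fun w =>
    if w = v then π L.1
    else match S.ago (G.dist v w) with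
      | some r => (r v).1
      | none => u w
  let r : Fin m → Fin k × ℝ := fun w => (act w, x w (act w))
  ⟨r :: S.log, L.1 ++ [r v], L.2⟩

/-- The state after `n` rounds of QuACK. -/
def run {m k : ℕ} (G : SimpleGraph (Fin m)) (v : Fin m) (π : List (Fin k × ℝ) → Fin k)
    (x : ℕ → Fin m → Fin k → ℝ) (u : ℕ → Fin m → Fin k) : ℕ → State m k
  | 0 => State.init m k
  | n + 1 => step G v π (x n) (u n) (run G v π x u n)

/-- `T_{aw}(n)`: how often agent `w` plays action `a` in the first `n` rounds. -/
def plays {m k : ℕ} (G : SimpleGraph (Fin m)) (v : Fin m) (π : List (Fin k × ℝ) → Fin k)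
    (x : ℕ → Fin m → Fin k → ℝ) (u : ℕ → Fin m → Fin k) (n : ℕ) (w : Fin m) (a : Fin k) : ℕ :=
  (run G v π x u n).log.countP fun r => (r w).1 = a

/-- The randomness of the interaction: `X t w a` is the reward that agent `w` obtains in round `t`
if it plays `a`, of law `ν a`; `U t w` is the uniformly random action of agent `w` in round `t`, used
only while no instruction of the leader has arrived. All these variables are independent. -/
structure IsEnvironment {Ω : Type*} [MeasurableSpace Ω] (P : Measure Ω) {m k : ℕ}
    (ν : Fin k → Measure ℝ) (X : ℕ → Fin m → Fin k → Ω → ℝ) (U : ℕ → Fin m → Ω → Fin k) :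
    Prop where
  measurable_reward : ∀ t w a, Measurable (X t w a)
  map_reward : ∀ t w a, P.map (X t w a) = ν a
  measurable_explore : ∀ t w, Measurable (U t w)
  uniform_explore : ∀ t w a, P {ω | U t w ω = a} = (k : ENNReal)⁻¹
  indep_reward : iIndepFun (fun i : ℕ × Fin m × Fin k => X i.1 i.2.1 i.2.2) P
  indep_explore : iIndepFun (fun i : ℕ × Fin m => U i.1 i.2) P
  indep : IndepFun (fun ω (i : ℕ × Fin m × Fin k) => X i.1 i.2.1 i.2.2 ω)
    (fun ω (i : ℕ × Fin m) => U i.1 i.2 ω) P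

/-- Group regret `R_G(n) = ∑_a Δ_a E[∑_w T_{aw}(n)]` of QuACK with leader `v` and single-agent
algorithm `π`. -/
def groupRegret {Ω : Type*} [MeasurableSpace Ω] (P : Measure Ω) {m k : ℕ}
    (ν : Fin k → Measure ℝ) (X : ℕ → Fin m → Fin k → Ω → ℝ) (U : ℕ → Fin m → Ω → Fin k)
    (G : SimpleGraph (Fin m)) (v : Fin m) (π : List (Fin k × ℝ) → Fin k) (n : ℕ) : ℝ :=
  ∑ a, gap ν a *
    ∫ ω, ∑ w, (plays G v π (fun t w a => X t w a ω) (fun t w => U t w ω) n w a : ℝ) ∂P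

theorem iterate_serve_empty {k : ℕ} (π : List (Fin k × ℝ) → Fin k) (N : ℕ) :
    ∀ s : List (Fin k × ℝ) × (Fin k → List ℝ), queued s.2 ≤ N →
      ((serve π)^[N] s).2 (π ((serve π)^[N] s).1) = [] := by
  induction N with
  | zero =>
    intro s hs
    have h0 : (s.2 (π s.1)).length ≤ queued s.2 :=
      Finset.single_le_sum (f := fun a => (s.2 a).length) (fun _ _ => Nat.zero_le _)
        (Finset.mem_univ (π s.1))
    exact List.eq_nil_of_length_eq_zero (by simp only [Function.iterate_zero, id]; omega)
  | succ N ih =>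
    intro s hs
    rw [Function.iterate_succ_apply]
    rcases hq : s.2 (π s.1) with _ | ⟨x, xs⟩
    · have h1 : serve π s = s := by simp [serve, hq]
      have h2 : ∀ j, (serve π)^[j] s = s := fun j => Function.iterate_fixed h1 j
      rw [h1, h2 N, hq]
    · apply ih
      have h1 : serve π s = (s.1 ++ [(π s.1, x)], Function.update s.2 (π s.1) xs) := by
        simp [serve, hq]
      rw [h1]
      have h2 : queued (Function.update s.2 (π s.1) xs) < queued s.2 := by
        apply Finset.sum_lt_sum
        · intro b _
          by_cases hb : b = π s.1
          · subst hb; simp [hq]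
          · simp [Function.update_of_ne hb]
        · exact ⟨π s.1, Finset.mem_univ _, by simp [hq]⟩
      simp only
      omega

/-- When the leader's loop ends, the queue of the selected action is empty. -/
theorem drain_empty {k : ℕ} (π : List (Fin k × ℝ) → Fin k)
    (s : List (Fin k × ℝ) × (Fin k → List ℝ)) : (drain π s).2 (π (drain π s).1) = [] :=
  iterate_serve_empty π _ s le_rfl

end Quack

end

/-! The order in which (round, agent) places reach the leader, `slots`, depends on the graph alone.
Whether a place carries action `a` is determined by the exploratory actions and the rewards at
earlier places (`action_congr_of_slots`), while the reward at the place is independent of these. The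
arriving rewards of `a` therefore concentrate like an i.i.d. sample of `ν a`. Queues are first-in
first-out and the leader plays only an action whose queue is empty, so what `π` has seen of `a` is
always a prefix of these arrivals (`samples_append_queue`). The delays thus leave the single-agent
analysis of `π` intact, with at most `m * n` rounds.

Concentration: for each `s` and each direction, `exists_weight` gives factors of mean at most one
whose product is at least `1 / δ` as soon as the truncated mean of the first `s` samples deviates by
`4 * width`. Multiplying in a factor whenever an arriving place carries `a` gives a supermartingale
(`lintegral_weight_append_le`), and Markov's inequality yields `measure_deviation_le`.

Counting: once `a` has more than `s₀` samples, of order `σ^(1/ε) log(mn) / Δ^((1+ε)/ε)`, `8 * width`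
is below its gap, so a further selection needs a deviation of `a` or of a best action
(`length_samples_take_le`). In round `t` of `π` this has probability at most `2 / t`, which sums to
`2 log(mn)`.

Delay: at the end of the last round in which the leader plays `a`, its queue is empty, so all plays
that have arrived are accounted for. For agent `w` at distance `d` at most `2 * d` plays are missed
(`sum_plays_le`). These combine in `integral_plays_le`; `gap_mul_le` absorbs the lower-order terms
using `Δ ≤ 4 σ^(1/(1+ε))`. -/

noncomputable section

namespace Quack

/-! ### Moments of truncated variables. -/

section Analysis

/-- Truncation level of the sample with (zero-based) position `i` when `L = ln (1/δ)`. -/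
def level (ε σ L : ℝ) (i : ℕ) : ℝ := (σ * ((i : ℝ) + 1) / L) ^ (1 / (1 + ε))

/-- Truncation of `x` at level `B`. -/
def trunc (B x : ℝ) : ℝ := if |x| ≤ B then x else 0

/-- A quarter of the exploration bonus after `s` samples. -/
def width (ε σ L : ℝ) (s : ℕ) : ℝ := σ ^ (1 / (1 + ε)) * (L / s) ^ (ε / (1 + ε))

theorem measurable_trunc (B : ℝ) : Measurable (trunc B) := by
  unfold trunc
  exact Measurable.ite (measurableSet_le measurable_abs measurable_const) measurable_id
    measurable_const

theorem abs_trunc_le {B : ℝ} (hB : 0 ≤ B) (x : ℝ) : |trunc B x| ≤ B := by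
  unfold trunc
  split_ifs with h
  · exact h
  · simpa using hB

/-- Only `|x| > B` contributes, and there `1 ≤ (|x| / B) ^ ε`. -/
theorem abs_sub_trunc_le {B ε : ℝ} (hB : 0 < B) (hε : 0 < ε) (x : ℝ) :
    |x - trunc B x| ≤ |x| ^ (1 + ε) / B ^ ε := by
  unfold trunc
  split_ifs with h
  · simp only [sub_self, abs_zero]; positivity
  · push Not at h
    have hx : 0 < |x| := hB.trans h
    rw [sub_zero, le_div_iff₀ (by positivity), Real.rpow_add hx, Real.rpow_one]
    gcongr

theorem trunc_sq_le {B ε : ℝ} (hB : 0 < B) (hε1 : ε ≤ 1) (x : ℝ) :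
    trunc B x ^ 2 ≤ |x| ^ (1 + ε) * B ^ (1 - ε) := by
  unfold trunc
  split_ifs with h
  · rcases eq_or_ne x 0 with rfl | h0
    · simp only [ne_eq, OfNat.ofNat_ne_zero, not_false_eq_true, zero_pow]; positivity
    · have hx : 0 < |x| := abs_pos.2 h0
      calc x ^ 2 = |x| ^ (1 + ε) * |x| ^ (1 - ε) := by
            rw [← Real.rpow_add hx, ← sq_abs, ← Real.rpow_natCast]; norm_num
        -- The exponent `1 - ε` is nonnegative, so `|x| ≤ B` may be inserted in the second factor.
        _ ≤ _ := by
            gcongr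
  · simp only [ne_eq, OfNat.ofNat_ne_zero, not_false_eq_true, zero_pow]; positivity

theorem integrable_trunc {ν : Measure ℝ} [IsProbabilityMeasure ν] {B : ℝ} (hB : 0 ≤ B) :
    Integrable (trunc B) ν :=
  Integrable.of_bound (measurable_trunc B).aestronglyMeasurable B
    (Filter.Eventually.of_forall fun x => by simpa using abs_trunc_le hB x)

theorem integrable_id_of_moment {ν : Measure ℝ} [IsProbabilityMeasure ν] {ε : ℝ} (hε : 0 < ε)
    (hint : Integrable (fun x : ℝ => |x| ^ (1 + ε)) ν) : Integrable (fun x : ℝ => x) ν := by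
  refine Integrable.mono' (hint.add (integrable_const (1 : ℝ)))
    measurable_id.aestronglyMeasurable (Filter.Eventually.of_forall fun x => ?_)
  simp only [Real.norm_eq_abs, Pi.add_apply]
  rcases le_total |x| 1 with h | h
  · have := Real.rpow_nonneg (abs_nonneg x) (1 + ε)
    linarith
  · have := Real.rpow_le_rpow_of_exponent_le h (show (1 : ℝ) ≤ 1 + ε by linarith)
    rw [Real.rpow_one] at this
    linarith

/-- Bias of the truncated variable. -/
theorem abs_mean_sub_trunc_le {ν : Measure ℝ} [IsProbabilityMeasure ν] {ε σ B : ℝ} (hε : 0 < ε)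
    (hB : 0 < B) (hint : Integrable (fun x : ℝ => |x| ^ (1 + ε)) ν)
    (hmom : ∫ x, |x| ^ (1 + ε) ∂ν ≤ σ) :
    |(∫ x, trunc B x ∂ν) - ∫ x, x ∂ν| ≤ σ / B ^ ε := by
  rw [abs_sub_comm, ← integral_sub (integrable_id_of_moment hε hint) (integrable_trunc hB.le)]
  calc |∫ x, (x - trunc B x) ∂ν| ≤ ∫ x, |x - trunc B x| ∂ν := abs_integral_le_integral_abs
    _ ≤ ∫ x, |x| ^ (1 + ε) / B ^ ε ∂ν :=
        integral_mono_of_nonneg (Filter.Eventually.of_forall fun x => abs_nonneg _)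
          (hint.div_const _) (Filter.Eventually.of_forall fun x => abs_sub_trunc_le hB hε x)
    _ = (∫ x, |x| ^ (1 + ε) ∂ν) / B ^ ε := integral_div _ _
    _ ≤ _ := by gcongr

theorem integral_trunc_sq_le {ν : Measure ℝ} {ε σ B : ℝ}
    (hε1 : ε ≤ 1) (hB : 0 < B) (hint : Integrable (fun x : ℝ => |x| ^ (1 + ε)) ν)
    (hmom : ∫ x, |x| ^ (1 + ε) ∂ν ≤ σ) :
    ∫ x, trunc B x ^ 2 ∂ν ≤ σ * B ^ (1 - ε) := by
  calc ∫ x, trunc B x ^ 2 ∂ν ≤ ∫ x, |x| ^ (1 + ε) * B ^ (1 - ε) ∂ν :=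
        integral_mono_of_nonneg (Filter.Eventually.of_forall fun x => sq_nonneg _)
          (hint.mul_const _) (Filter.Eventually.of_forall fun x => trunc_sq_le hB hε1 x)
    _ = (∫ x, |x| ^ (1 + ε) ∂ν) * B ^ (1 - ε) := integral_mul_const _ _
    _ ≤ _ := by gcongr

/-- Moment generating function of a centred bounded variable. -/
theorem integral_exp_centered_le {ν : Measure ℝ} [IsProbabilityMeasure ν] {Y : ℝ → ℝ} {c V : ℝ}
    (hY : Measurable Y) (hb : ∀ x, |c * Y x| ≤ 1) (hV : c ^ 2 * ∫ x, Y x ^ 2 ∂ν ≤ V)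
    (hint : Integrable Y ν) :
    ∫⁻ x, ENNReal.ofReal (Real.exp (c * (Y x - ∫ y, Y y ∂ν) - V)) ∂ν ≤ 1 := by
  set μ := ∫ y, Y y ∂ν with hμ
  have hsq : Integrable (fun x => (c * Y x) ^ 2) ν :=
    Integrable.of_bound ((hY.const_mul c).pow_const 2).aestronglyMeasurable 1
      (Filter.Eventually.of_forall fun x => by
        rw [Real.norm_eq_abs, abs_pow]; exact pow_le_one₀ (abs_nonneg _) (hb x))
  -- The quadratic bound for `exp` on `[-1, 1]`; after integration, `1 + y ≤ exp y` turns it back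
  -- into an exponential that cancels the centring and `V`.
  have hexp : ∀ x, Real.exp (c * Y x) ≤ 1 + c * Y x + (c * Y x) ^ 2 := fun x => by
    have := (abs_le.1 (Real.abs_exp_sub_one_sub_id_le (hb x))).2
    linarith
  have hq : Integrable (fun x => 1 + c * Y x + (c * Y x) ^ 2) ν :=
    ((integrable_const _).add (hint.const_mul c)).add hsq
  have hle : ∀ x, Real.exp (c * (Y x - μ) - V)
      ≤ Real.exp (-(c * μ) - V) * (1 + c * Y x + (c * Y x) ^ 2) := fun x => by
    rw [show c * (Y x - μ) - V = (-(c * μ) - V) + c * Y x by ring, Real.exp_add]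
    exact mul_le_mul_of_nonneg_left (hexp x) (Real.exp_pos _).le
  have hI : ∫ x, (1 + c * Y x + (c * Y x) ^ 2) ∂ν = 1 + c * μ + c ^ 2 * ∫ x, Y x ^ 2 ∂ν := by
    have h1 : Integrable (fun x => 1 + c * Y x) ν := (integrable_const _).add (hint.const_mul c)
    rw [integral_add h1 hsq, integral_add (integrable_const _) (hint.const_mul c),
      integral_const_mul]
    simp only [mul_pow, integral_const_mul]
    simp [hμ]
  calc ∫⁻ x, ENNReal.ofReal (Real.exp (c * (Y x - μ) - V)) ∂ν
      ≤ ∫⁻ x, ENNReal.ofReal (Real.exp (-(c * μ) - V) * (1 + c * Y x + (c * Y x) ^ 2)) ∂ν :=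
        lintegral_mono fun x => ENNReal.ofReal_le_ofReal (hle x)
    _ = ENNReal.ofReal (∫ x, Real.exp (-(c * μ) - V) * (1 + c * Y x + (c * Y x) ^ 2) ∂ν) := by
        rw [ofReal_integral_eq_lintegral_ofReal (hq.const_mul _)]
        exact Filter.Eventually.of_forall fun x =>
          mul_nonneg (Real.exp_pos _).le ((Real.exp_pos _).le.trans (hexp x))
    _ ≤ ENNReal.ofReal 1 := by
        apply ENNReal.ofReal_le_ofReal
        rw [integral_const_mul, hI]
        have h1 : 1 + c * μ + c ^ 2 * ∫ x, Y x ^ 2 ∂ν ≤ Real.exp (c * μ + V) := by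
          have := Real.add_one_le_exp (c * μ + V)
          linarith
        calc _ ≤ Real.exp (-(c * μ) - V) * Real.exp (c * μ + V) := by gcongr
          _ = 1 := by rw [← Real.exp_add]; simp
    _ = 1 := by simp

/-- With `q = 1 / (1 + ε)`, Bernoulli's inequality gives `q (s+1)^(q-1) ≤ (s+1)^q - s^q`, which
telescopes. The constant 2 bounds `1 / q`, by `ε ≤ 1`. -/
theorem sum_rpow_neg_le {ε : ℝ} (hε : 0 < ε) (hε1 : ε ≤ 1) (s : ℕ) :
    ∑ i ∈ Finset.range s, ((i : ℝ) + 1) ^ (-(ε / (1 + ε))) ≤ 2 * (s : ℝ) ^ (1 / (1 + ε)) := by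
  have hq0 : 0 < 1 / (1 + ε) := by positivity
  have hq1 : 1 / (1 + ε) ≤ 1 := by rw [div_le_one (by positivity)]; linarith
  have hq2 : 1 / 2 ≤ 1 / (1 + ε) := by gcongr; linarith
  have hp : -(ε / (1 + ε)) = 1 / (1 + ε) - 1 := by field_simp; ring
  rw [hp]
  set q := 1 / (1 + ε)
  induction s with
  | zero => simp [Real.zero_rpow hq0.ne']
  | succ s ih =>
    rw [Finset.sum_range_succ]
    have hs : (0 : ℝ) < s + 1 := by positivity
    have hB := rpow_one_add_le_one_add_mul_self (s := -1 / ((s : ℝ) + 1)) (p := q)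
      (by rw [le_div_iff₀ hs]; linarith [(Nat.cast_nonneg s : (0 : ℝ) ≤ s)]) hq0.le hq1
    have h1 : 1 + -1 / ((s : ℝ) + 1) = s / (s + 1) := by field_simp; ring
    rw [h1, Real.div_rpow (Nat.cast_nonneg s) hs.le, div_le_iff₀ (by positivity)] at hB
    have h2 : ((s : ℝ) + 1) ^ (q - 1) = ((s : ℝ) + 1) ^ q / (s + 1) := by
      rw [Real.rpow_sub hs, Real.rpow_one]
    have h3 : (1 + q * (-1 / ((s : ℝ) + 1))) * ((s : ℝ) + 1) ^ q
        = ((s : ℝ) + 1) ^ q - q * ((s : ℝ) + 1) ^ (q - 1) := by rw [h2]; ring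
    have h4 : 0 ≤ ((s : ℝ) + 1) ^ (q - 1) := by positivity
    push_cast
    nlinarith

/-! ### Truncation levels and widths. -/

variable {ε σ L : ℝ}

theorem level_pos (hσ : 0 < σ) (hL : 0 < L) (i : ℕ) : 0 < level ε σ L i := by
  unfold level; positivity

theorem level_mono (hε : 0 < ε) (hσ : 0 < σ) (hL : 0 < L) {i j : ℕ} (h : i ≤ j) :
    level ε σ L i ≤ level ε σ L j := by
  unfold level; gcongr

theorem level_rpow (hε : 0 < ε) (hσ : 0 < σ) (hL : 0 < L) (i : ℕ) :
    level ε σ L i ^ (1 + ε) = σ * ((i : ℝ) + 1) / L := by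
  unfold level
  rw [← Real.rpow_mul (by positivity), one_div_mul_cancel (by positivity), Real.rpow_one]

/-- This fixes the scale of the exponential weights: with tilt `1 / level`, a deviation of `s + 1`
widths costs exactly `L`. Levels count samples from 0 and widths from 1, hence the shift. -/
theorem width_div_level (hε : 0 < ε) (hσ : 0 < σ) (hL : 0 < L) (s : ℕ) :
    width ε σ L (s + 1) / level ε σ L s = L / (s + 1) := by
  have hs : (0 : ℝ) < s + 1 := by positivity
  rw [div_eq_iff (level_pos hσ hL s).ne']
  unfold level width
  have h1 : σ * ((s : ℝ) + 1) / L = σ * (L / (s + 1))⁻¹ := by rw [inv_div]; ring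
  have h0 : 0 < L / ((s : ℝ) + 1) := by positivity
  rw [h1, Real.mul_rpow hσ.le (by positivity), Real.inv_rpow h0.le, ← Real.rpow_neg h0.le]
  have h2 : L / ((s : ℝ) + 1) * (σ ^ (1 / (1 + ε)) * (L / ((s : ℝ) + 1)) ^ (-(1 / (1 + ε))))
      = σ ^ (1 / (1 + ε)) * ((L / ((s : ℝ) + 1)) ^ (1 : ℝ)
        * (L / ((s : ℝ) + 1)) ^ (-(1 / (1 + ε)))) := by rw [Real.rpow_one]; ring
  rw [h2, ← Real.rpow_add h0]
  push_cast
  congr 2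
  field_simp
  ring

/-- The bias of sample `i` decays like `(i+1)^(-ε/(1+ε))`, so the average bias is at most two
widths, half of the deviation in `exists_weight`. -/
theorem sum_bias_le (hε : 0 < ε) (hε1 : ε ≤ 1) (hσ : 0 < σ) (hL : 0 < L) (s : ℕ) :
    ∑ i ∈ Finset.range (s + 1), σ / level ε σ L i ^ ε ≤ 2 * ((s + 1 : ℕ) * width ε σ L (s + 1)) := by
  have h0 : 0 < σ / L := by positivity
  have hterm : ∀ i : ℕ, σ / level ε σ L i ^ ε
      = σ * (σ / L) ^ (-(ε / (1 + ε))) * ((i : ℝ) + 1) ^ (-(ε / (1 + ε))) := fun i => by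
    unfold level
    have h1 : σ * ((i : ℝ) + 1) / L = (σ / L) * (i + 1) := by ring
    rw [h1, ← Real.rpow_mul (by positivity), div_eq_mul_inv, ← Real.rpow_neg (by positivity),
      Real.mul_rpow h0.le (by positivity), mul_assoc,
      show -(1 / (1 + ε) * ε) = -(ε / (1 + ε)) by ring]
  simp_rw [hterm]
  rw [← Finset.mul_sum]
  refine (mul_le_mul_of_nonneg_left (sum_rpow_neg_le hε hε1 (s + 1)) (by positivity)).trans_eq ?_
  unfold width
  have hs : (0 : ℝ) < ((s + 1 : ℕ) : ℝ) := by positivity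
  have e1 : σ * (σ / L) ^ (-(ε / (1 + ε))) = σ ^ (1 / (1 + ε)) * L ^ (ε / (1 + ε)) := by
    rw [Real.div_rpow hσ.le hL.le, Real.rpow_neg hL.le, div_inv_eq_mul, ← mul_assoc]
    congr 1
    nth_rewrite 1 [← Real.rpow_one σ]
    rw [← Real.rpow_add hσ]
    congr 1
    field_simp
    ring
  have e2 : ((s + 1 : ℕ) : ℝ) ^ (1 / (1 + ε))
      = (s + 1 : ℕ) / ((s + 1 : ℕ) : ℝ) ^ (ε / (1 + ε)) := by
    nth_rewrite 2 [← Real.rpow_one ((s + 1 : ℕ) : ℝ)]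
    rw [← Real.rpow_sub hs]
    congr 1
    field_simp
    ring
  rw [e1, e2, Real.div_rpow hL.le hs.le]
  ring

/-! ### Exponential weights for the truncated mean. -/

/-- Product of the weights `f i` over the entries of a list. -/
def weight (f : ℕ → ℝ → ENNReal) (xs : List ℝ) : ENNReal :=
  ∏ i ∈ Finset.range xs.length, f i (xs.getD i 0)

theorem weight_append (f : ℕ → ℝ → ENNReal) (xs : List ℝ) (y : ℝ) :
    weight f (xs ++ [y]) = weight f xs * f xs.length y := by
  unfold weight
  rw [List.length_append, List.length_singleton, Finset.prod_range_succ]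
  congr 1
  · refine Finset.prod_congr rfl fun i hi => ?_
    rw [List.getD_append _ _ _ _ (Finset.mem_range.1 hi)]
  · simp

theorem truncatedMean_eq (δ : ℝ) (xs : List ℝ) :
    truncatedMean ε σ δ xs
      = (∑ i ∈ Finset.range xs.length, trunc (level ε σ (Real.log (1 / δ)) i) (xs.getD i 0))
        / xs.length := by
  unfold truncatedMean trunc level
  rw [Finset.sum_range]
  simp

/-- Exponential weights of mean at most one that certify deviations of the truncated mean: for
`κ = 1` those above and for `κ = -1` those below the true mean. -/
theorem exists_weight {ν : Measure ℝ} [IsProbabilityMeasure ν] (hε : 0 < ε) (hε1 : ε ≤ 1)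
    (hσ : 0 < σ) (hint : Integrable (fun x : ℝ => |x| ^ (1 + ε)) ν)
    (hmom : ∫ x, |x| ^ (1 + ε) ∂ν ≤ σ) {δ κ : ℝ} (hδ0 : 0 < δ) (hδ : 0 < Real.log (1 / δ)) (hκ : |κ| = 1)
    {s : ℕ} (hs : s ≠ 0) :
    ∃ f : ℕ → ℝ → ENNReal, (∀ i, Measurable (f i)) ∧ (∀ i, ∫⁻ x, f i x ∂ν ≤ 1) ∧
      ∀ xs : List ℝ, s ≤ xs.length →
        4 * width ε σ (Real.log (1 / δ)) s ≤ κ * (truncatedMean ε σ δ (xs.take s) - ∫ x, x ∂ν) →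
        ENNReal.ofReal (1 / δ) ≤ weight f xs := by
  obtain ⟨s, rfl⟩ : ∃ j, s = j + 1 := Nat.exists_eq_succ_of_ne_zero hs
  set L := Real.log (1 / δ) with hLdef
  set B := level ε σ L s with hB
  have hBpos : 0 < B := level_pos hσ hδ s
  set Y : ℕ → ℝ → ℝ := fun i => trunc (level ε σ L i) with hY
  set V := L / ((s : ℝ) + 1) with hV
  have hs0 : (0 : ℝ) < s + 1 := by positivity
  -- The tilt is the inverse of the largest level used, which keeps every exponent in `[-1, 1]`. `V`
  -- bounds the tilted second moment, since `σ / B ^ (1 + ε) = V`. Factors beyond the first `s + 1`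
  -- samples are trivial.
  refine ⟨fun i x => if i < s + 1 then
      ENNReal.ofReal (Real.exp (κ / B * (Y i x - ∫ y, Y i y ∂ν) - V)) else 1, ?_, ?_, ?_⟩
  · intro i
    dsimp only
    split_ifs
    · exact ((((measurable_trunc _).sub_const _).const_mul _).sub_const _).exp.ennreal_ofReal
    · exact measurable_const
  · intro i
    dsimp only
    split_ifs with hi
    · have hile : level ε σ L i ≤ B := level_mono hε hσ hδ (by omega)
      have hip := level_pos (ε := ε) hσ hδ i
      refine integral_exp_centered_le (measurable_trunc _) (fun x => ?_) ?_
        (integrable_trunc hip.le)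
      · rw [abs_mul, abs_div, hκ, abs_of_pos hBpos, one_div, inv_mul_le_iff₀ hBpos, mul_one]
        exact (abs_trunc_le hip.le x).trans hile
      · have h1 := integral_trunc_sq_le hε1 hip hint hmom
        have h2 : level ε σ L i ^ (1 - ε) ≤ B ^ (1 - ε) := by
          apply Real.rpow_le_rpow hip.le hile; linarith
        have h3 : ∫ x, Y i x ^ 2 ∂ν ≤ σ * B ^ (1 - ε) := h1.trans (by gcongr)
        have h4 : (κ / B) ^ 2 = 1 / B ^ 2 := by
          rw [div_pow, ← sq_abs κ, hκ, one_pow]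
        have h5 : B ^ 2 = B ^ (1 + ε) * B ^ (1 - ε) := by
          rw [← Real.rpow_add hBpos, ← Real.rpow_natCast]; norm_num
        rw [h4, one_div, inv_mul_le_iff₀ (by positivity), h5, level_rpow hε hσ hδ]
        refine h3.trans_eq ?_
        rw [hV]; field_simp
    · simp
  · intro xs hxs hdev
    have hlen : (xs.take (s + 1)).length = s + 1 := by simp; omega
    rw [truncatedMean_eq, hlen] at hdev
    have hgetD : ∀ i ∈ Finset.range (s + 1), Y i ((xs.take (s + 1)).getD i 0) = Y i (xs.getD i 0) := by
      intro i hi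
      congr 1
      rw [Finset.mem_range] at hi
      simp [List.getD_eq_getElem?_getD, hi]
    rw [← hLdef] at hdev
    change 4 * _ ≤ κ * ((∑ i ∈ Finset.range (s + 1), Y i ((xs.take (s + 1)).getD i 0)) / _ - _) at hdev
    rw [Finset.sum_congr rfl hgetD] at hdev
    set μ := ∫ x, x ∂ν
    set S := ∑ i ∈ Finset.range (s + 1), Y i (xs.getD i 0)
    set w := width ε σ L (s + 1)
    have hbias : κ * ((∑ i ∈ Finset.range (s + 1), ∫ y, Y i y ∂ν) - (s + 1 : ℕ) * μ)
        ≤ 2 * ((s + 1 : ℕ) * w) := by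
      refine (le_abs_self _).trans ?_
      rw [abs_mul, hκ, one_mul]
      have : (∑ i ∈ Finset.range (s + 1), ∫ y, Y i y ∂ν) - (s + 1 : ℕ) * μ
          = ∑ i ∈ Finset.range (s + 1), ((∫ y, Y i y ∂ν) - μ) := by
        rw [Finset.sum_sub_distrib]; simp
      rw [this]
      refine (Finset.abs_sum_le_sum_abs _ _).trans ((Finset.sum_le_sum fun i _ => ?_).trans
        (sum_bias_le hε hε1 hσ hδ s))
      exact abs_mean_sub_trunc_le hε (level_pos hσ hδ i) hint hmom
    have hdev2 : 2 * ((s + 1 : ℕ) * w) ≤ κ * (S - ∑ i ∈ Finset.range (s + 1), ∫ y, Y i y ∂ν) := by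
      have h1 := mul_le_mul_of_nonneg_left hdev hs0.le
      have h2 : ((s : ℝ) + 1) * (κ * (S / ((s + 1 : ℕ) : ℝ) - μ))
          = κ * (S - ((s + 1 : ℕ) : ℝ) * μ) := by push_cast; field_simp
      rw [h2] at h1
      have h3 : κ * (S - ∑ i ∈ Finset.range (s + 1), ∫ y, Y i y ∂ν)
        = κ * (S - ((s + 1 : ℕ) : ℝ) * μ)
          - κ * ((∑ i ∈ Finset.range (s + 1), ∫ y, Y i y ∂ν) - (s + 1 : ℕ) * μ) := by ring
      rw [h3]
      push_cast at *
      linarith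
    -- Of the four widths two pay for the bias; the other two contribute `2 * L`, and the
    -- compensators `V` take back `L`.
    have hexpo : L ≤ ∑ i ∈ Finset.range (s + 1),
        (κ / B * (Y i (xs.getD i 0) - ∫ y, Y i y ∂ν) - V) := by
      rw [Finset.sum_sub_distrib, ← Finset.mul_sum, Finset.sum_sub_distrib]
      have hVs : ∑ _i ∈ Finset.range (s + 1), V = L := by
        rw [hV]; simp; field_simp
      rw [hVs]
      have hwB : w / B = V := width_div_level hε hσ hδ s
      have h6 := div_le_div_of_nonneg_right hdev2 hBpos.le
      have h7 : 2 * (((s + 1 : ℕ) : ℝ) * w) / B = 2 * L := by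
        rw [show 2 * (((s + 1 : ℕ) : ℝ) * w) / B = 2 * ((s + 1 : ℕ) : ℝ) * (w / B) by ring, hwB, hV]
        push_cast; field_simp
      rw [h7] at h6
      have h8 : κ * (S - ∑ i ∈ Finset.range (s + 1), ∫ y, Y i y ∂ν) / B
        = κ / B * (S - ∑ i ∈ Finset.range (s + 1), ∫ y, Y i y ∂ν) := by ring
      rw [h8] at h6
      linarith
    unfold weight
    rw [← Finset.prod_subset (Finset.range_subset_range.2 hxs)]
    swap
    · intro i _ hi
      rw [Finset.mem_range] at hi
      simp [hi]
    rw [Finset.prod_congr rfl (g := fun i => ENNReal.ofReal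
      (Real.exp (κ / B * (Y i (xs.getD i 0) - ∫ y, Y i y ∂ν) - V)))
      (fun i hi => by dsimp only; rw [if_pos (Finset.mem_range.1 hi)]),
      ← ENNReal.ofReal_prod_of_nonneg (fun i _ => (Real.exp_pos _).le), ← Real.exp_sum]
    apply ENNReal.ofReal_le_ofReal
    calc 1 / δ = Real.exp L := (Real.exp_log (one_div_pos.2 hδ0)).symm
      _ ≤ _ := Real.exp_le_exp.2 hexpo

end Analysis

section Tagged

/-! ### QuACK with tagged rewards

Rewards are replaced by the pair (round, agent) in which they are obtained. -/

section Generic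

variable {k : ℕ} {β : Type*}

/-- The payloads of action `a` in a history, in chronological order. -/
def tagSamples (h : List (Fin k × β)) (a : Fin k) : List β :=
  h.filterMap fun p => if p.1 = a then some p.2 else none

theorem tagSamples_append (h h' : List (Fin k × β)) (a : Fin k) :
    tagSamples (h ++ h') a = tagSamples h a ++ tagSamples h' a := List.filterMap_append

theorem tagSamples_singleton (b : Fin k) (y : β) (a : Fin k) :
    tagSamples [(b, y)] a = if b = a then [y] else [] := by
  unfold tagSamples
  by_cases h : b = a <;> simp [h]

theorem tagSamples_map (A : β → Fin k) (l : List β) (a : Fin k) :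
    tagSamples (l.map fun e => (A e, e)) a = l.filter fun e => A e = a := by
  induction l with
  | nil => rfl
  | cons e l ih =>
    rw [List.map_cons, ← List.singleton_append, tagSamples_append, tagSamples_singleton, ih]
    by_cases h : A e = a <;> simp [h]

theorem sum_length_tagSamples (h : List (Fin k × β)) :
    ∑ a, (tagSamples h a).length = h.length := by
  induction h with
  | nil => simp [tagSamples]
  | cons p h ih =>
    obtain ⟨b, y⟩ := p
    have hcons : ∀ a, (tagSamples ((b, y) :: h) a).length
        = (if b = a then 1 else 0) + (tagSamples h a).length := fun a => by
      rw [← List.singleton_append, tagSamples_append, tagSamples_singleton, List.length_append]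
      split_ifs <;> rfl
    rw [Finset.sum_congr rfl fun a _ => hcons a, Finset.sum_add_distrib, ih, List.length_cons,
      add_comm]
    congr 1
    rw [Finset.sum_eq_single b]
    · simp
    · intro a _ hab
      simp [hab.symm]
    · simp

/-- One pass of the leader's loop on tagged rewards. -/
def tagServe (ρ : List (Fin k × β) → Fin k)
    (s : List (Fin k × β) × (Fin k → List β)) : List (Fin k × β) × (Fin k → List β) :=
  match s.2 (ρ s.1) with
  | [] => s
  | y :: ys => (s.1 ++ [(ρ s.1, y)], Function.update s.2 (ρ s.1) ys)

/-- The leader's loop on tagged rewards. -/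
def tagDrain (ρ : List (Fin k × β) → Fin k)
    (s : List (Fin k × β) × (Fin k → List β)) : List (Fin k × β) × (Fin k → List β) :=
  (tagServe ρ)^[∑ a, (s.2 a).length] s

/-- A history in which each action is the one that `ρ` selects. -/
def Follows (ρ : List (Fin k × β) → Fin k) (h : List (Fin k × β)) : Prop :=
  ∀ i (hi : i < h.length), h[i].1 = ρ (h.take i)

theorem Follows.append {ρ : List (Fin k × β) → Fin k} {h : List (Fin k × β)} (H : Follows ρ h)
    (y : β) : Follows ρ (h ++ [(ρ h, y)]) := by
  intro i hi
  rw [List.length_append, List.length_singleton] at hi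
  rcases Nat.lt_succ_iff_lt_or_eq.1 hi with h1 | rfl
  · rw [List.getElem_append_left h1, List.take_append_of_le_length h1.le]
    exact H i h1
  · simp

theorem tagServe_induction {ρ : List (Fin k × β) → Fin k}
    (C : List (Fin k × β) × (Fin k → List β) → Prop)
    (hC : ∀ h Q y ys, Q (ρ h) = y :: ys → C (h, Q) →
      C (h ++ [(ρ h, y)], Function.update Q (ρ h) ys))
    {s : List (Fin k × β) × (Fin k → List β)} (hs : C s) : C (tagServe ρ s) := by
  unfold tagServe
  split
  · exact hs
  · rename_i y ys h
    exact hC _ _ _ _ h hs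

theorem tagDrain_induction {ρ : List (Fin k × β) → Fin k}
    (C : List (Fin k × β) × (Fin k → List β) → Prop)
    (hC : ∀ h Q y ys, Q (ρ h) = y :: ys → C (h, Q) →
      C (h ++ [(ρ h, y)], Function.update Q (ρ h) ys))
    {s : List (Fin k × β) × (Fin k → List β)} (hs : C s) : C (tagDrain ρ s) := by
  unfold tagDrain
  generalize ∑ a, (s.2 a).length = N
  induction N with
  | zero => exact hs
  | succ N ih =>
    rw [Function.iterate_succ_apply']
    exact tagServe_induction C hC ih

/-- The head of the queue moves to the end of the samples: this is where first-in first-out is used.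
-/
theorem samples_append_queue_update {ρ : List (Fin k × β) → Fin k} {h : List (Fin k × β)}
    {Q : Fin k → List β} {y : β} {ys : List β} (hq : Q (ρ h) = y :: ys) (a : Fin k) :
    tagSamples (h ++ [(ρ h, y)]) a ++ Function.update Q (ρ h) ys a = tagSamples h a ++ Q a := by
  rw [tagSamples_append, tagSamples_singleton]
  by_cases hb : ρ h = a
  · subst hb
    simp [hq]
  · simp [hb, Function.update_of_ne (Ne.symm hb)]

theorem tagDrain_samples (ρ : List (Fin k × β) → Fin k)
    (s : List (Fin k × β) × (Fin k → List β)) (a : Fin k) :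
    tagSamples (tagDrain ρ s).1 a ++ (tagDrain ρ s).2 a = tagSamples s.1 a ++ s.2 a :=
  tagDrain_induction (C := fun s' => tagSamples s'.1 a ++ s'.2 a = tagSamples s.1 a ++ s.2 a)
    (fun _ _ _ _ hq h => (samples_append_queue_update hq a).trans h) rfl

theorem tagDrain_follows {ρ : List (Fin k × β) → Fin k}
    {s : List (Fin k × β) × (Fin k → List β)} (hs : Follows ρ s.1) :
    Follows ρ (tagDrain ρ s).1 :=
  tagDrain_induction (C := fun s' => Follows ρ s'.1) (fun _ _ _ _ _ h => h.append _) hs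

theorem tagDrain_prefix (ρ : List (Fin k × β) → Fin k)
    (s : List (Fin k × β) × (Fin k → List β)) : s.1 <+: (tagDrain ρ s).1 :=
  tagDrain_induction (C := fun s' => s.1 <+: s'.1)
    (fun _ _ _ _ _ h => h.trans (List.prefix_append _ _)) (List.prefix_refl _)

/-- The loop only uses the selections on histories built from the given payloads. -/
theorem tagDrain_congr {ρ ρ' : List (Fin k × β) → Fin k} {D : β → Prop}
    (hρ : ∀ h : List (Fin k × β), (∀ p ∈ h, D p.2) → ρ h = ρ' h)
    {s : List (Fin k × β) × (Fin k → List β)} (h1 : ∀ p ∈ s.1, D p.2)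
    (h2 : ∀ a, ∀ y ∈ s.2 a, D y) :
    tagDrain ρ s = tagDrain ρ' s ∧ ∀ p ∈ (tagDrain ρ s).1, D p.2 := by
  unfold tagDrain
  generalize ∑ a, (s.2 a).length = N
  suffices H : (tagServe ρ)^[N] s = (tagServe ρ')^[N] s ∧
      (∀ p ∈ ((tagServe ρ)^[N] s).1, D p.2) ∧ ∀ a, ∀ y ∈ ((tagServe ρ)^[N] s).2 a, D y from
    ⟨H.1, H.2.1⟩
  induction N with
  | zero => exact ⟨rfl, h1, h2⟩
  | succ N ih =>
    rw [Function.iterate_succ_apply', Function.iterate_succ_apply', ← ih.1]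
    obtain ⟨-, i1, i2⟩ := ih
    generalize (tagServe ρ)^[N] s = s' at i1 i2
    have e := hρ _ i1
    refine ⟨by simp only [tagServe, e], ?_⟩
    unfold tagServe
    split
    · exact ⟨i1, i2⟩
    · rename_i y ys hq
      have hy : ∀ z ∈ y :: ys, D z := fun z hz => i2 (ρ s'.1) z (hq ▸ hz)
      refine ⟨fun p hp => ?_, fun a z hz => ?_⟩
      · rcases List.mem_append.1 hp with hp | hp
        · exact i1 p hp
        · rw [List.mem_singleton.1 hp]
          exact hy _ List.mem_cons_self
      · by_cases ha : a = ρ s'.1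
        · subst ha
          simp only [Function.update_self] at hz
          exact hy _ (List.mem_cons_of_mem _ hz)
        · simp only [Function.update_of_ne ha] at hz
          exact i2 _ _ hz

/-- The loop commutes with revealing the rewards. -/
theorem drain_map (f : Fin k → β → ℝ) (π : List (Fin k × ℝ) → Fin k)
    (s : List (Fin k × β) × (Fin k → List β)) :
    drain π (s.1.map fun p => (p.1, f p.1 p.2), fun a => (s.2 a).map (f a))
      = ((tagDrain (fun h => π (h.map fun p => (p.1, f p.1 p.2))) s).1.map
          fun p => (p.1, f p.1 p.2),
        fun a => ((tagDrain (fun h => π (h.map fun p => (p.1, f p.1 p.2))) s).2 a).map (f a)) := by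
  unfold drain tagDrain queued
  simp only [List.length_map]
  generalize ∑ a, (s.2 a).length = N
  induction N with
  | zero => rfl
  | succ N ih =>
    rw [Function.iterate_succ_apply', Function.iterate_succ_apply', ih]
    generalize (tagServe _)^[N] s = s'
    obtain ⟨h, Q⟩ := s'
    simp only [serve, tagServe]
    generalize hb : π (h.map fun p => (p.1, f p.1 p.2)) = b
    rcases hq : Q b with _ | ⟨y, ys⟩
    · simp
    · simp only [List.map_cons, List.map_append, List.map_nil, Prod.mk.injEq, true_and]
      funext a
      by_cases ha : a = b
      · subst ha; simp
      · simp [Function.update_of_ne ha]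

end Generic

/-! ### The tagged network and its agreement with `run`. -/

variable {m k : ℕ}

/-- State of the network between two rounds, with tagged rewards. -/
structure TagState (m k : ℕ) where
  /-- Round number and actions of all agents, most recent round first. -/
  log : List (ℕ × (Fin m → Fin k))
  /-- Actions and tags fed so far to the single-agent algorithm. -/
  hist : List (Fin k × (ℕ × Fin m))
  /-- The queues of tags. -/
  queue : Fin k → List (ℕ × Fin m)

/-- Replace the tags by the rewards `x`. -/
def TagState.reveal (x : ℕ → Fin m → Fin k → ℝ) (S : TagState m k) : State m k where
  log := S.log.map fun r w => (r.2 w, x r.1 w (r.2 w))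
  hist := S.hist.map fun p => (p.1, x p.2.1 p.2.2 p.1)
  queue := fun a => (S.queue a).map fun e => x e.1 e.2 a

/-- The selection of the algorithm on a tagged history. -/
def tagPolicy (π : List (Fin k × ℝ) → Fin k) (x : ℕ → Fin m → Fin k → ℝ)
    (h : List (Fin k × (ℕ × Fin m))) : Fin k := π (h.map fun p => (p.1, x p.2.1 p.2.2 p.1))

/-- Messages that reach the leader. -/
def tagInbox (G : SimpleGraph (Fin m)) (v : Fin m) (log : List (ℕ × (Fin m → Fin k))) :
    List (Fin k × (ℕ × Fin m)) :=
  (List.finRange m).filterMap fun w =>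
    if w = v then none else (log[G.dist v w - 1]?).map fun r => (r.2 w, (r.1, w))

/-- The leader's state after receiving the messages of the round. -/
def tagLoad (G : SimpleGraph (Fin m)) (v : Fin m) (S : TagState m k) :
    List (Fin k × (ℕ × Fin m)) × (Fin k → List (ℕ × Fin m)) :=
  (S.hist, fun a => S.queue a ++ tagSamples (tagInbox G v S.log) a)

/-- The actions of the round. -/
def tagAct (G : SimpleGraph (Fin m)) (v : Fin m) (ρ : List (Fin k × (ℕ × Fin m)) → Fin k)
    (u : Fin m → Fin k) (S : TagState m k) (w : Fin m) : Fin k :=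
  if w = v then ρ (tagDrain ρ (tagLoad G v S)).1
  else match S.log[G.dist v w - 1]? with
    | some r => r.2 v
    | none => u w

/-- Round `t` with tagged rewards. -/
def tagStep (G : SimpleGraph (Fin m)) (v : Fin m) (ρ : List (Fin k × (ℕ × Fin m)) → Fin k)
    (t : ℕ) (u : Fin m → Fin k) (S : TagState m k) : TagState m k where
  log := (t, tagAct G v ρ u S) :: S.log
  hist := (tagDrain ρ (tagLoad G v S)).1 ++ [(tagAct G v ρ u S v, (t, v))]
  queue := (tagDrain ρ (tagLoad G v S)).2

/-- The tagged state after `n` rounds. -/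
def tagRun (G : SimpleGraph (Fin m)) (v : Fin m) (π : List (Fin k × ℝ) → Fin k)
    (x : ℕ → Fin m → Fin k → ℝ) (u : ℕ → Fin m → Fin k) : ℕ → TagState m k
  | 0 => ⟨[], [], fun _ => []⟩
  | n + 1 => tagStep G v (tagPolicy π x) n (u n) (tagRun G v π x u n)

/-- The action of agent `w` in round `t`. -/
def action (G : SimpleGraph (Fin m)) (v : Fin m) (π : List (Fin k × ℝ) → Fin k)
    (x : ℕ → Fin m → Fin k → ℝ) (u : ℕ → Fin m → Fin k) (t : ℕ) (w : Fin m) : Fin k :=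
  tagAct G v (tagPolicy π x) (u t) (tagRun G v π x u t) w

theorem reveal_inbox (G : SimpleGraph (Fin m)) (v : Fin m) (x : ℕ → Fin m → Fin k → ℝ)
    (S : TagState m k) :
    inbox G v (S.reveal x)
      = (tagInbox G v S.log).map fun p => (p.1, x p.2.1 p.2.2 p.1) := by
  unfold inbox tagInbox State.ago TagState.reveal
  rw [List.map_filterMap]
  congr 1
  funext w
  by_cases h : w = v
  · simp [h]
  · simp [h, Function.comp_def]

theorem samples_map (x : ℕ → Fin m → Fin k → ℝ) (h : List (Fin k × (ℕ × Fin m))) (a : Fin k) :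
    samples (h.map fun p => (p.1, x p.2.1 p.2.2 p.1)) a
      = (tagSamples h a).map fun e => x e.1 e.2 a := by
  unfold samples tagSamples
  rw [List.map_filterMap, List.filterMap_map]
  congr 1
  funext p
  by_cases h : p.1 = a
  · simp [h]
  · simp [h]

/-- The action vector and the drained pair become free variables, so that each can be replaced by
its tagged counterpart. -/
theorem step_eq (G : SimpleGraph (Fin m)) (v : Fin m) (π : List (Fin k × ℝ) → Fin k)
    (x : Fin m → Fin k → ℝ) (u : Fin m → Fin k) (S : State m k)
    {A : Fin m → Fin k} {L : List (Fin k × ℝ) × (Fin k → List ℝ)}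
    (hA : A = fun w => if w = v then π (drain π (S.hist,
        fun a => S.queue a ++ samples (inbox G v S) a)).1
      else match S.ago (G.dist v w) with
        | some r => (r v).1
        | none => u w)
    (hL : L = drain π (S.hist, fun a => S.queue a ++ samples (inbox G v S) a)) :
    step G v π x u S = ⟨(fun w => (A w, x w (A w))) :: S.log, L.1 ++ [(A v, x v (A v))], L.2⟩ := by
  subst hA hL
  rfl

theorem step_reveal (G : SimpleGraph (Fin m)) (v : Fin m) (π : List (Fin k × ℝ) → Fin k)
    (x : ℕ → Fin m → Fin k → ℝ) (u : Fin m → Fin k) (t : ℕ) (S : TagState m k) :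
    step G v π (x t) u (S.reveal x) = (tagStep G v (tagPolicy π x) t u S).reveal x := by
  have hQ : (fun a => (S.reveal x).queue a ++ samples (inbox G v (S.reveal x)) a)
      = fun a => ((tagLoad G v S).2 a).map fun e => x e.1 e.2 a := by
    funext a
    rw [reveal_inbox, samples_map]
    simp [tagLoad, TagState.reveal]
  have hD := drain_map (fun a e => x e.1 e.2 a) π (tagLoad G v S)
  have hact : ∀ w, (if w = v then π (drain π ((S.reveal x).hist,
        fun a => (S.reveal x).queue a ++ samples (inbox G v (S.reveal x)) a)).1
      else match (S.reveal x).ago (G.dist v w) with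
        | some r => (r v).1
        | none => u w) = tagAct G v (tagPolicy π x) u S w := by
    intro w
    unfold tagAct
    by_cases h : w = v
    · rw [if_pos h, if_pos h, hQ]
      exact congrArg π (congrArg Prod.fst hD)
    · rw [if_neg h, if_neg h]
      simp only [State.ago, TagState.reveal, List.getElem?_map]
      rcases S.log[G.dist v w - 1]? with _ | r <;> rfl
  rw [step_eq G v π (x t) u _ (funext hact).symm (hQ ▸ hD).symm]
  simp only [TagState.reveal, tagStep, List.map_cons, List.map_append, List.map_nil]
  rfl

theorem run_eq_reveal (G : SimpleGraph (Fin m)) (v : Fin m) (π : List (Fin k × ℝ) → Fin k)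
    (x : ℕ → Fin m → Fin k → ℝ) (u : ℕ → Fin m → Fin k) (n : ℕ) :
    run G v π x u n = (tagRun G v π x u n).reveal x := by
  induction n with
  | zero => rfl
  | succ n ih => rw [run, ih, step_reveal, tagRun]

end Tagged

section Arrival

variable {m k : ℕ}

/-! ### Order of arrival -/

/-- The (round, agent) pairs whose rewards reach the leader in round `t`, without its own. -/
def incoming (G : SimpleGraph (Fin m)) (v : Fin m) (t : ℕ) : List (ℕ × Fin m) :=
  (List.finRange m).filterMap fun w =>
    if w = v then none else if G.dist v w ≤ t then some (t - G.dist v w, w) else none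

/-- The (round, agent) pairs whose rewards reach the leader in the first `n` rounds, in the order
of arrival. -/
def slots (G : SimpleGraph (Fin m)) (v : Fin m) : ℕ → List (ℕ × Fin m)
  | 0 => []
  | n + 1 => slots G v n ++ (incoming G v n ++ [(n, v)])

theorem mem_incoming {G : SimpleGraph (Fin m)} {v : Fin m} {t : ℕ} {e : ℕ × Fin m} :
    e ∈ incoming G v t ↔ e.2 ≠ v ∧ e.1 + G.dist v e.2 = t := by
  obtain ⟨τ, w⟩ := e
  unfold incoming
  simp only [List.mem_filterMap, List.mem_finRange, true_and]
  constructor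
  · rintro ⟨w', h⟩
    split_ifs at h with h1 h2
    simp only [Option.some.injEq, Prod.mk.injEq] at h
    obtain ⟨rfl, rfl⟩ := h
    exact ⟨h1, by omega⟩
  · rintro ⟨h1, h2⟩
    refine ⟨w, ?_⟩
    rw [if_neg h1, if_pos (by omega)]
    simp only [Option.some.injEq, Prod.mk.injEq, and_true]
    omega

theorem mem_slots {G : SimpleGraph (Fin m)} {v : Fin m} {n : ℕ} {e : ℕ × Fin m} :
    e ∈ slots G v n ↔ e.1 + G.dist v e.2 < n := by
  induction n with
  | zero => simp [slots]
  | succ n ih =>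
    rw [slots, List.mem_append, List.mem_append, ih, mem_incoming, List.mem_singleton]
    obtain ⟨τ, w⟩ := e
    by_cases hw : w = v
    · subst hw
      simp only [SimpleGraph.dist_self, Prod.mk.injEq]
      simp
      omega
    · simp [hw]
      omega

/-- Each place arrives only once; this makes an arriving reward distinct from all earlier ones,
hence independent of them. -/
theorem nodup_slots (G : SimpleGraph (Fin m)) (v : Fin m) (n : ℕ) : (slots G v n).Nodup := by
  induction n with
  | zero => exact List.nodup_nil
  | succ n ih =>
    rw [slots, List.nodup_append', List.nodup_append']
    refine ⟨ih, ⟨?_, List.nodup_singleton _, ?_⟩, ?_⟩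
    · refine List.Nodup.filterMap ?_ (List.nodup_finRange m)
      intro w w' b hb hb'
      simp only [Option.mem_def] at hb hb'
      split_ifs at hb hb'
      simp only [Option.some.injEq] at hb hb'
      rw [← hb'] at hb
      exact congrArg Prod.snd hb
    · rw [List.disjoint_singleton]
      exact fun h => (mem_incoming.1 h).1 rfl
    · intro e h1 h2
      rw [mem_slots] at h1
      rcases List.mem_append.1 h2 with h2 | h2
      · have := (mem_incoming.1 h2).2
        omega
      · rw [List.mem_singleton.1 h2] at h1
        simp at h1

/-- The arrived rewards, agent by agent. -/
theorem length_filter_slots (G : SimpleGraph (Fin m)) (v : Fin m) (p : ℕ × Fin m → Prop)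
    [DecidablePred p] (n : ℕ) :
    ((slots G v n).filter fun e => p e).length
      = ∑ w, ((Finset.range (n - G.dist v w)).filter fun τ => p (τ, w)).card := by
  classical
  rw [← List.toFinset_card_of_nodup ((nodup_slots G v n).filter _)]
  have : ((slots G v n).filter fun e => p e).toFinset
      = Finset.univ.biUnion fun w : Fin m =>
        ((Finset.range (n - G.dist v w)).filter fun τ => p (τ, w)).map
          ⟨fun τ => (τ, w), fun _ _ h => congrArg Prod.fst h⟩ := by
    ext ⟨τ, w⟩
    simp only [List.mem_toFinset, List.mem_filter, mem_slots, decide_eq_true_eq,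
      Finset.mem_biUnion, Finset.mem_univ, true_and, Finset.mem_map, Finset.mem_filter,
      Finset.mem_range]
    constructor
    · rintro ⟨h1, h2⟩
      exact ⟨w, τ, ⟨by omega, h2⟩, rfl⟩
    · rintro ⟨w', τ', ⟨h1, h2⟩, h3⟩
      obtain ⟨rfl, rfl⟩ : τ' = τ ∧ w' = w := Prod.mk.inj h3
      exact ⟨by omega, h2⟩
  rw [this, Finset.card_biUnion]
  · simp
  · intro w _ w' _ hne
    rw [Function.onFun, Finset.disjoint_left]
    intro e he he'
    simp only [Finset.mem_map] at he he'
    obtain ⟨τ, -, rfl⟩ := he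
    obtain ⟨τ', -, h⟩ := he'
    exact hne (congrArg Prod.snd h).symm

theorem length_slots_le (G : SimpleGraph (Fin m)) (v : Fin m) (n : ℕ) :
    (slots G v n).length ≤ m * n := by
  have h := length_filter_slots G v (fun _ => True) n
  simp only [decide_true, List.filter_true, Finset.filter_true, Finset.card_range] at h
  rw [h]
  refine (Finset.sum_le_sum fun w _ => Nat.sub_le n _).trans ?_
  simp

/-! ### Invariants of the run -/

section Run

variable (G : SimpleGraph (Fin m)) (v : Fin m) (π : List (Fin k × ℝ) → Fin k)
  (x : ℕ → Fin m → Fin k → ℝ) (u : ℕ → Fin m → Fin k)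

theorem tagRun_log (n : ℕ) :
    (tagRun G v π x u n).log = (List.range n).reverse.map fun t => (t, action G v π x u t) := by
  induction n with
  | zero => rfl
  | succ n ih =>
    rw [tagRun, tagStep, ih, List.range_succ, List.reverse_append, List.map_append]
    rfl

theorem tagRun_log_getElem? (n d : ℕ) (hd : 0 < d) :
    (tagRun G v π x u n).log[d - 1]?
      = if d ≤ n then some (n - d, action G v π x u (n - d)) else none := by
  rw [tagRun_log, List.getElem?_map]
  split_ifs with h
  · rw [List.getElem?_reverse (by simp; omega), List.getElem?_range (by simp; omega)]
    simp only [List.length_range, Option.map_some]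
    rw [show n - 1 - (d - 1) = n - d by omega]
  · rw [List.getElem?_eq_none (by simp; omega)]
    rfl

variable {G v} in
theorem dist_pos_of_ne (hG : G.Connected) {w : Fin m} (hw : w ≠ v) : 0 < G.dist v w :=
  hG.pos_dist_of_ne hw.symm

variable {G v} in
theorem action_follower (hG : G.Connected) {w : Fin m} (hw : w ≠ v) {t : ℕ}
    (ht : G.dist v w ≤ t) :
    action G v π x u t w = action G v π x u (t - G.dist v w) v := by
  rw [action, tagAct, if_neg hw, tagRun_log_getElem? G v π x u t _ (dist_pos_of_ne hG hw),
    if_pos ht]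

variable {G v} in
theorem tagInbox_tagRun (hG : G.Connected) (n : ℕ) :
    tagInbox G v (tagRun G v π x u n).log
      = (incoming G v n).map fun e => (action G v π x u e.1 e.2, e) := by
  unfold tagInbox incoming
  rw [List.map_filterMap]
  congr 1
  funext w
  by_cases hw : w = v
  · simp [hw]
  · rw [if_neg hw, if_neg hw, tagRun_log_getElem? G v π x u n _ (dist_pos_of_ne hG hw)]
    split_ifs <;> rfl

variable {G v} in
theorem tagLoad_tagRun (hG : G.Connected) (n : ℕ) (a : Fin k) :
    (tagLoad G v (tagRun G v π x u n)).2 a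
      = (tagRun G v π x u n).queue a
        ++ (incoming G v n).filter fun e => action G v π x u e.1 e.2 = a := by
  rw [tagLoad, tagInbox_tagRun π x u hG]
  simp only
  rw [tagSamples_map (fun e : ℕ × Fin m => action G v π x u e.1 e.2)]

/-- When the leader's loop ends, the queue of the selected action is empty. -/
theorem tagDrain_empty (s : List (Fin k × (ℕ × Fin m)) × (Fin k → List (ℕ × Fin m))) :
    (tagDrain (tagPolicy π x) s).2 (tagPolicy π x (tagDrain (tagPolicy π x) s).1) = [] := by
  have h := drain_empty π (s.1.map fun p => (p.1, x p.2.1 p.2.2 p.1),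
    fun a => (s.2 a).map fun e => x e.1 e.2 a)
  rw [drain_map (fun a (e : ℕ × Fin m) => x e.1 e.2 a) π s] at h
  exact List.map_eq_nil_iff.1 h

theorem tagRun_queue_eq_nil (n : ℕ) :
    (tagRun G v π x u (n + 1)).queue (action G v π x u n v) = [] := by
  rw [action, tagAct, if_pos rfl]
  exact tagDrain_empty π x _

variable {G v} in
/-- What the algorithm has seen of an action, followed by what is queued, is what has arrived. -/
theorem samples_append_queue (hG : G.Connected) (n : ℕ) (a : Fin k) :
    tagSamples (tagRun G v π x u n).hist a ++ (tagRun G v π x u n).queue a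
      = (slots G v n).filter fun e => action G v π x u e.1 e.2 = a := by
  induction n with
  | zero => rfl
  | succ n ih =>
    have hq := tagRun_queue_eq_nil G v π x u n
    have hD := tagDrain_samples (tagPolicy π x) (tagLoad G v (tagRun G v π x u n)) a
    rw [tagLoad_tagRun π x u hG, ← List.append_assoc] at hD
    rw [slots, List.filter_append, List.filter_append, ← ih, ← List.append_assoc]
    change tagSamples (_ ++ [(action G v π x u n v, (n, v))]) a ++ _ = _
    rw [tagSamples_append, tagSamples_singleton]
    change _ = (tagSamples (tagLoad G v (tagRun G v π x u n)).1 a ++ _ ++ _) ++ _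
    rw [← hD]
    -- The leader's own reward is fed directly, bypassing the queue. Order is preserved because the
    -- queue of the action played is empty.
    by_cases ha : action G v π x u n v = a
    · subst ha
      have hq' : (tagDrain (tagPolicy π x) (tagLoad G v (tagRun G v π x u n))).2
        (action G v π x u n v) = [] := hq
      rw [hq]
      simp [hq']
    · simp [ha, tagRun, tagStep]

theorem tagRun_follows (n : ℕ) : Follows (tagPolicy π x) (tagRun G v π x u n).hist := by
  induction n with
  | zero => exact fun i hi => absurd hi (Nat.not_lt_zero i)
  | succ n ih =>
    have h := (tagDrain_follows (s := tagLoad G v (tagRun G v π x u n)) ih).append (n, v)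
    rw [tagRun, tagStep, tagAct, if_pos rfl]
    exact h

theorem tagRun_hist_prefix {i j : ℕ} (h : i ≤ j) :
    (tagRun G v π x u i).hist <+: (tagRun G v π x u j).hist := by
  induction j, h using Nat.le_induction with
  | base => exact List.prefix_refl _
  | succ n _ ih =>
    exact ih.trans ((tagDrain_prefix _ (tagLoad G v (tagRun G v π x u n))).trans
      (List.prefix_append _ _))

variable {G v} in
-- Everything fed to `π` has arrived at the leader, so the internal clock of `π` stays below `m *
-- n`, the source of the logarithm in the regret.
theorem length_hist_le (hG : G.Connected) (n : ℕ) : (tagRun G v π x u n).hist.length ≤ m * n := by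
  rw [← sum_length_tagSamples]
  calc ∑ a, (tagSamples (tagRun G v π x u n).hist a).length
      ≤ ∑ a, (tagSamples ((slots G v n).map fun e => (action G v π x u e.1 e.2, e)) a).length := by
        refine Finset.sum_le_sum fun a _ => ?_
        rw [tagSamples_map (fun e : ℕ × Fin m => action G v π x u e.1 e.2),
          ← samples_append_queue π x u hG, List.length_append]
        omega
    _ = (slots G v n).length := by rw [sum_length_tagSamples, List.length_map]
    _ ≤ m * n := length_slots_le G v n

theorem plays_eq (n : ℕ) (w : Fin m) (a : Fin k) :
    plays G v π x u n w a = ((Finset.range n).filter fun t => action G v π x u t w = a).card := by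
  unfold plays
  rw [run_eq_reveal]
  simp only [TagState.reveal]
  rw [tagRun_log]
  induction n with
  | zero => rfl
  | succ n ih =>
    rw [List.range_succ, List.reverse_append, List.map_append, List.map_append, List.countP_append,
      ih, Finset.range_add_one, Finset.filter_insert]
    by_cases h : action G v π x u n w = a
    · simp [h]
      omega
    · simp [h]

/-- `T` is the end of the last round in which the leader played `a`, or 0 if there is none. -/
theorem exists_queue_empty (n : ℕ) (a : Fin k) :
    ∃ T ≤ n, (tagRun G v π x u T).queue a = [] ∧ ∀ t, T ≤ t → t < n → action G v π x u t v ≠ a := by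
  induction n with
  | zero => exact ⟨0, le_rfl, rfl, fun t _ h => absurd h (Nat.not_lt_zero t)⟩
  | succ n ih =>
    by_cases ha : action G v π x u n v = a
    · refine ⟨n + 1, le_rfl, ?_, fun t h1 h2 => by omega⟩
      rw [← ha]
      exact tagRun_queue_eq_nil G v π x u n
    · obtain ⟨T, h1, h2, h3⟩ := ih
      refine ⟨T, by omega, h2, fun t ht1 ht2 => ?_⟩
      rcases Nat.lt_succ_iff_lt_or_eq.1 ht2 with h | rfl
      · exact h3 t ht1 h
      · exact ha

variable {G v} in
/-- All but a bounded number of the plays of an action have been fed to the algorithm. -/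
theorem sum_plays_le (hG : G.Connected) (n : ℕ) (a : Fin k) :
    ∑ w, plays G v π x u n w a
      ≤ (tagSamples (tagRun G v π x u n).hist a).length + 2 * ∑ w, G.dist v w := by
  obtain ⟨T, hT, hq, hne⟩ := exists_queue_empty G v π x u n a
  have h1 : ((slots G v T).filter fun e => action G v π x u e.1 e.2 = a).length
      ≤ (tagSamples (tagRun G v π x u n).hist a).length := by
    rw [← samples_append_queue π x u hG, hq, List.append_nil]
    exact ((tagRun_hist_prefix G v π x u hT).sublist.filterMap _).length_le
  rw [length_filter_slots G v (fun e => action G v π x u e.1 e.2 = a)] at h1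
  simp only at h1
  have h2 : ∀ w, plays G v π x u n w a
      ≤ ((Finset.range (T - G.dist v w)).filter fun τ => action G v π x u τ w = a).card
        + 2 * G.dist v w := by
    intro w
    rw [plays_eq]
    -- Plays before `T - d` had arrived by `T`, when the queue of `a` was empty, so they were fed.
    -- What remains lies in a window of at most `2 * d` rounds.
    have hsub : ((Finset.range n).filter fun t => action G v π x u t w = a)
        ⊆ ((Finset.range (T - G.dist v w)).filter fun τ => action G v π x u τ w = a)
          ∪ Finset.Ico (T - G.dist v w) (T + G.dist v w) := by
      intro t ht
      simp only [Finset.mem_filter, Finset.mem_range, Finset.mem_union, Finset.mem_Ico] at ht ⊢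
      by_cases h3 : t < T - G.dist v w
      · exact Or.inl ⟨h3, ht.2⟩
      · refine Or.inr ⟨by omega, ?_⟩
        -- From round `T + d` on, `w` copies a round of the leader at or after `T`, in which `a` is
        -- not played.
        by_contra h4
        by_cases hw : w = v
        · subst hw
          simp only [SimpleGraph.dist_self] at h4
          exact hne t (by omega) ht.1 ht.2
        · rw [action_follower π x u hG hw (by omega)] at ht
          exact hne _ (by omega) (by omega) ht.2
    refine (Finset.card_le_card hsub).trans ((Finset.card_union_le _ _).trans ?_)
    rw [Nat.card_Ico]
    omega
  refine (Finset.sum_le_sum fun w _ => h2 w).trans ?_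
  rw [Finset.sum_add_distrib, ← Finset.mul_sum]
  omega

end Run

/-! ### Which rewards the actions depend on -/

section Locality

variable {G : SimpleGraph (Fin m)} {v : Fin m} (π : List (Fin k × ℝ) → Fin k)
  {x x' : ℕ → Fin m → Fin k → ℝ} (u : ℕ → Fin m → Fin k)

theorem tagPolicy_congr {h : List (Fin k × (ℕ × Fin m))}
    (hx : ∀ p ∈ h, x p.2.1 p.2.2 = x' p.2.1 p.2.2) : tagPolicy π x h = tagPolicy π x' h := by
  unfold tagPolicy
  congr 1
  exact List.map_congr_left fun p hp => by rw [hx p hp]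

theorem mem_slots_of_mem_tagLoad (hG : G.Connected) (n : ℕ) :
    (∀ p ∈ (tagLoad G v (tagRun G v π x u n)).1, p.2 ∈ slots G v n) ∧
      ∀ a, ∀ e ∈ (tagLoad G v (tagRun G v π x u n)).2 a, e ∈ slots G v n ++ incoming G v n := by
  have hs : ∀ a e, e ∈ tagSamples (tagRun G v π x u n).hist a ++ (tagRun G v π x u n).queue a →
      e ∈ slots G v n := fun a e he => by
    rw [samples_append_queue π x u hG] at he
    exact List.mem_of_mem_filter he
  refine ⟨fun p hp => hs p.1 _ (List.mem_append_left _ ?_), fun a e he => ?_⟩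
  · exact List.mem_filterMap.2 ⟨p, hp, by simp⟩
  · rw [tagLoad_tagRun π x u hG] at he
    rcases List.mem_append.1 he with he | he
    · exact List.mem_append_left _ (hs a e (List.mem_append_right _ he))
    · exact List.mem_append_right _ (List.mem_of_mem_filter he)

/-- The loop reads only rewards that are stored or just received; the leader's own reward of the
round enters the tagged state only as a tag. -/
theorem tagRun_succ_congr (hG : G.Connected) {n : ℕ}
    (hn : tagRun G v π x u n = tagRun G v π x' u n)
    (hx : ∀ e ∈ slots G v n ++ incoming G v n, x e.1 e.2 = x' e.1 e.2) :
    action G v π x u n = action G v π x' u n ∧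
      tagRun G v π x u (n + 1) = tagRun G v π x' u (n + 1) := by
  obtain ⟨h1, h2⟩ := mem_slots_of_mem_tagLoad (x := x) π u hG n (v := v)
  have hρ : ∀ h : List (Fin k × (ℕ × Fin m)),
      (∀ p ∈ h, p.2 ∈ slots G v n ++ incoming G v n) → tagPolicy π x h = tagPolicy π x' h :=
    fun h hh => tagPolicy_congr π fun p hp => hx p.2 (hh p hp)
  obtain ⟨hd, hm⟩ := tagDrain_congr (D := fun e => e ∈ slots G v n ++ incoming G v n) hρ
    (fun p hp => List.mem_append_left _ (h1 p hp)) h2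
  have hact : action G v π x u n = action G v π x' u n := by
    funext w
    rw [action, action, ← hn, tagAct, tagAct, ← hd, hρ _ hm]
  refine ⟨hact, ?_⟩
  have hact' : tagAct G v (tagPolicy π x) (u n) (tagRun G v π x u n)
    = tagAct G v (tagPolicy π x') (u n) (tagRun G v π x' u n) := hact
  rw [tagRun, tagRun, tagStep, tagStep, hact', ← hn, hd]

theorem tagRun_congr (hG : G.Connected) {n : ℕ}
    (hx : ∀ e ∈ slots G v n, x e.1 e.2 = x' e.1 e.2) :
    tagRun G v π x u n = tagRun G v π x' u n := by
  induction n with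
  | zero => rfl
  | succ n ih =>
    rw [slots, ← List.append_assoc] at hx
    refine (tagRun_succ_congr π u hG (ih fun e he => ?_) fun e he => ?_).2
    · exact hx e (List.mem_append_left _ (List.mem_append_left _ he))
    · exact hx e (List.mem_append_left _ he)

theorem action_eq_of_tagRun_eq {t n : ℕ} (ht : t < n)
    (h : tagRun G v π x u n = tagRun G v π x' u n) (w : Fin m) :
    action G v π x u t w = action G v π x' u t w := by
  have h1 := congrArg TagState.log h
  rw [tagRun_log, tagRun_log, List.map_inj_left] at h1
  exact congrFun (congrArg Prod.snd (h1 t (by simpa using ht))) w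

theorem append_eq_append_cons {α : Type*} {l l' l₁ l₂ : List α} {e : α}
    (h : l ++ l' = l₁ ++ e :: l₂) :
    (∃ r, l₁ = l ++ r ∧ l' = r ++ e :: l₂) ∨ ∃ r, l = l₁ ++ e :: r := by
  rcases List.append_eq_append_iff.1 h with ⟨r, h1, h2⟩ | ⟨r, h1, h2⟩
  · exact Or.inl ⟨r, h1, h2⟩
  · rcases r with _ | ⟨b, r⟩
    · exact Or.inl ⟨[], by simpa using h1.symm, h2.symm⟩
    · rw [List.cons_append, List.cons.injEq] at h2
      exact Or.inr ⟨r, h2.1 ▸ h1⟩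

/-- The action behind an arriving reward is determined by the rewards that arrived earlier. -/
theorem action_congr_of_slots (hG : G.Connected) {n : ℕ} {l₁ l₂ : List (ℕ × Fin m)}
    {e : ℕ × Fin m} (hl : slots G v n = l₁ ++ e :: l₂)
    (hx : ∀ e' ∈ l₁, x e'.1 e'.2 = x' e'.1 e'.2) :
    action G v π x u e.1 e.2 = action G v π x' u e.1 e.2 := by
  induction n generalizing l₂ with
  | zero => simp [slots] at hl
  | succ n ih =>
    rw [slots] at hl
    rcases append_eq_append_cons hl with ⟨r, rfl, hr⟩ | ⟨r, hr⟩
    · have hn : tagRun G v π x u n = tagRun G v π x' u n :=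
        tagRun_congr π u hG fun e' he' => hx e' (List.mem_append_left _ he')
      rcases append_eq_append_cons hr with ⟨r', rfl, hr'⟩ | ⟨r', hr'⟩
      · obtain ⟨rfl, rfl⟩ : r' = [] ∧ e = (n, v) := by
          rcases r' with _ | ⟨b, r'⟩
          · rw [List.nil_append, List.cons.injEq] at hr'
            exact ⟨rfl, hr'.1.symm⟩
          · simp at hr'
        rw [List.append_nil] at hx
        rw [(tagRun_succ_congr π u hG hn hx).1]
      -- A follower is at positive distance, so its arriving reward belongs to a completed round,
      -- whose actions are already in the log.
      · have he : e ∈ incoming G v n := hr' ▸ List.mem_append_right _ List.mem_cons_self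
        obtain ⟨h1, h2⟩ := mem_incoming.1 he
        have := dist_pos_of_ne hG h1
        exact action_eq_of_tagRun_eq π u (by omega) hn _
    · exact ih hr

end Locality

end Arrival

section Sampling

/-! ### Measurability of the run -/

/-- A map all of whose fibres are measurable. -/
def FiberMeasurable {α β : Type*} [MeasurableSpace α] (f : α → β) : Prop :=
  ∀ b, MeasurableSet (f ⁻¹' {b})

namespace FiberMeasurable

variable {α β γ : Type*} [MeasurableSpace α]

theorem const (c : γ) : FiberMeasurable fun _ : α => c := fun b => by
  exact MeasurableSet.const (c = b)

theorem of_measurable [MeasurableSpace β] [MeasurableSingletonClass β] {f : α → β}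
    (hf : Measurable f) : FiberMeasurable f := fun b => hf (measurableSet_singleton b)

/-- Splitting over the countably many intermediate values replaces any σ-algebra on lists and
states. -/
theorem bind [Countable β] {f : α → β} (hf : FiberMeasurable f) {g : α → β → γ}
    (hg : ∀ b, FiberMeasurable fun p => g p b) : FiberMeasurable fun p => g p (f p) := fun c => by
  have : (fun p => g p (f p)) ⁻¹' {c} = ⋃ b, f ⁻¹' {b} ∩ (fun p => g p b) ⁻¹' {c} := by
    ext p; simp
  rw [this]
  exact MeasurableSet.iUnion fun b => (hf b).inter (hg b c)

theorem comp [Countable β] {f : α → β} (hf : FiberMeasurable f) (g : β → γ) :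
    FiberMeasurable fun p => g (f p) := hf.bind (g := fun _ b => g b) fun _ => const _

theorem measurable_bind [MeasurableSpace γ] [Countable β] {f : α → β} (hf : FiberMeasurable f)
    {g : α → β → γ} (hg : ∀ b, Measurable fun p => g p b) : Measurable fun p => g p (f p) := by
  intro s hs
  have : (fun p => g p (f p)) ⁻¹' s = ⋃ b, f ⁻¹' {b} ∩ (fun p => g p b) ⁻¹' s := by
    ext p; simp
  rw [this]
  exact MeasurableSet.iUnion fun b => (hf b).inter (hg b hs)

end FiberMeasurable

variable {m k : ℕ}

/-- The purpose of tagging: states that store tags instead of real rewards take countably many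
values. -/
instance : Countable (TagState m k) :=
  Function.Injective.countable (f := fun S : TagState m k => (S.log, S.hist, S.queue)) (by
    rintro ⟨a, b, c⟩ ⟨a', b', c'⟩ h
    simp only [Prod.mk.injEq] at h
    obtain ⟨rfl, rfl, rfl⟩ := h
    rfl)

/-- All rewards and exploratory actions. -/
abbrev Noise (m k : ℕ) : Type := (ℕ → Fin m → Fin k → ℝ) × (ℕ → Fin m → Fin k)

variable {G : SimpleGraph (Fin m)} {v : Fin m} {π : List (Fin k × ℝ) → Fin k}

theorem measurable_coord (t : ℕ) (w : Fin m) (a : Fin k) :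
    Measurable fun p : Noise m k => p.1 t w a := by fun_prop

theorem fiberMeasurable_tagPolicy (hπ : MeasurablePolicy π) (h : List (Fin k × (ℕ × Fin m))) :
    FiberMeasurable fun p : Noise m k => tagPolicy π p.1 h := by
  apply FiberMeasurable.of_measurable
  have h1 : ∀ p : Noise m k, tagPolicy π p.1 h
      = π (List.ofFn fun i : Fin h.length => (h[i].1, p.1 h[i].2.1 h[i].2.2 h[i].1)) := fun p => by
    unfold tagPolicy
    congr 1
    apply List.ext_getElem <;> simp
  simp_rw [h1]
  refine (hπ h.length).comp (measurable_pi_lambda _ fun i => ?_)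
  exact measurable_const.prodMk (measurable_coord _ _ _)

theorem fiberMeasurable_tagDrain (hπ : MeasurablePolicy π)
    (s : List (Fin k × (ℕ × Fin m)) × (Fin k → List (ℕ × Fin m))) :
    FiberMeasurable fun p : Noise m k => tagDrain (tagPolicy π p.1) s := by
  unfold tagDrain
  generalize ∑ a, (s.2 a).length = N
  induction N with
  | zero => exact FiberMeasurable.const _
  | succ N ih =>
    simp_rw [Function.iterate_succ_apply']
    refine ih.bind (g := fun p s' => tagServe (tagPolicy π p.1) s') fun s' => ?_
    refine (fiberMeasurable_tagPolicy hπ s'.1).bind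
      (g := fun p b => tagServe (fun _ => b) s') fun b => ?_
    exact FiberMeasurable.const _

theorem fiberMeasurable_tagRun (hπ : MeasurablePolicy π) (n : ℕ) :
    FiberMeasurable fun p : Noise m k => tagRun G v π p.1 p.2 n := by
  induction n with
  | zero => exact FiberMeasurable.const _
  | succ n ih =>
    refine ih.bind (g := fun p S => tagStep G v (tagPolicy π p.1) n (p.2 n) S) fun S => ?_
    have hu : FiberMeasurable fun p : Noise m k => p.2 n :=
      FiberMeasurable.of_measurable (by fun_prop)
    let A : Fin k → (Fin m → Fin k) → Fin m → Fin k := fun b u w =>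
      if w = v then b else match S.log[G.dist v w - 1]? with
        | some r => r.2 v
        | none => u w
    exact (fiberMeasurable_tagDrain hπ (tagLoad G v S)).bind
      (g := fun p L => (⟨(n, A (tagPolicy π p.1 L.1) (p.2 n)) :: S.log,
        L.1 ++ [(A (tagPolicy π p.1 L.1) (p.2 n) v, (n, v))], L.2⟩ : TagState m k)) fun L =>
      (fiberMeasurable_tagPolicy hπ L.1).bind
        (g := fun p b => (⟨(n, A b (p.2 n)) :: S.log,
          L.1 ++ [(A b (p.2 n) v, (n, v))], L.2⟩ : TagState m k)) fun b =>
        hu.comp fun u => (⟨(n, A b u) :: S.log, L.1 ++ [(A b u v, (n, v))], L.2⟩ : TagState m k)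

theorem fiberMeasurable_action (hπ : MeasurablePolicy π) (t : ℕ) (w : Fin m) :
    FiberMeasurable fun p : Noise m k => action G v π p.1 p.2 t w := by
  intro a
  have h := (fiberMeasurable_tagRun (G := G) (v := v) hπ (t + 1)).comp
    (fun S => S.log.head?.map fun r => r.2 w) (some a)
  convert h using 1
  ext p
  simp [tagRun_log, List.range_succ]

/-! ### The arriving rewards of an action -/

/-- The rewards of action `a` at the places `l` at which it is played. -/
def arrivals (G : SimpleGraph (Fin m)) (v : Fin m) (π : List (Fin k × ℝ) → Fin k) (a : Fin k)
    (l : List (ℕ × Fin m)) (p : Noise m k) : List ℝ :=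
  (l.filter fun e => action G v π p.1 p.2 e.1 e.2 = a).map fun e => p.1 e.1 e.2 a

theorem arrivals_append (a : Fin k) (l : List (ℕ × Fin m)) (e : ℕ × Fin m) (p : Noise m k) :
    arrivals G v π a (l ++ [e]) p = arrivals G v π a l p ++
      if action G v π p.1 p.2 e.1 e.2 = a then [p.1 e.1 e.2 a] else [] := by
  unfold arrivals
  rw [List.filter_append, List.map_append]
  congr 1
  by_cases h : action G v π p.1 p.2 e.1 e.2 = a <;> simp [h]

theorem fiberMeasurable_filter_action (hπ : MeasurablePolicy π) (a : Fin k)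
    (l : List (ℕ × Fin m)) : FiberMeasurable fun p : Noise m k =>
      l.filter fun e => action G v π p.1 p.2 e.1 e.2 = a := by
  induction l with
  | nil => exact FiberMeasurable.const _
  | cons e l ih =>
    have h := ih.bind
      (g := fun p l' => if action G v π p.1 p.2 e.1 e.2 = a then e :: l' else l') fun l' =>
        (fiberMeasurable_action hπ e.1 e.2).comp fun b => if b = a then e :: l' else l'
    convert h using 2 with p
    by_cases h : action G v π p.1 p.2 e.1 e.2 = a <;> simp [h]

/-- Keep only the rewards at the places `l`. -/
def mask (l : List (ℕ × Fin m)) (x : ℕ → Fin m → Fin k → ℝ) : ℕ → Fin m → Fin k → ℝ :=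
  fun t w => if (t, w) ∈ l then x t w else 0

theorem mask_of_mem {l : List (ℕ × Fin m)} (x : ℕ → Fin m → Fin k → ℝ) {e : ℕ × Fin m}
    (he : e ∈ l) : mask l x e.1 e.2 = x e.1 e.2 := if_pos he

theorem action_mask (hG : G.Connected) {n : ℕ} {l₁ l₂ : List (ℕ × Fin m)} {e : ℕ × Fin m}
    (hl : slots G v n = l₁ ++ e :: l₂) (p : Noise m k) :
    action G v π (mask l₁ p.1) p.2 e.1 e.2 = action G v π p.1 p.2 e.1 e.2 :=
  action_congr_of_slots π p.2 hG hl fun _ he => mask_of_mem p.1 he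

/-- The arrivals along an initial segment are a function of its rewards and the exploratory actions
alone, so later rewards may be set to 0. -/
theorem arrivals_mask (hG : G.Connected) {n : ℕ} {l₁ l₂ : List (ℕ × Fin m)}
    (hl : slots G v n = l₁ ++ l₂) (a : Fin k) (p : Noise m k) :
    arrivals G v π a l₁ (mask l₁ p.1, p.2) = arrivals G v π a l₁ p := by
  unfold arrivals
  have h1 : (l₁.filter fun e => action G v π (mask l₁ p.1) p.2 e.1 e.2 = a)
      = l₁.filter fun e => action G v π p.1 p.2 e.1 e.2 = a := by
    apply List.filter_congr
    intro e he
    obtain ⟨r, r', hr⟩ := List.append_of_mem he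
    have hl' : slots G v n = r ++ e :: (r' ++ l₂) := by rw [hl, hr]; simp
    rw [action_congr_of_slots (x := mask l₁ p.1) (x' := p.1) π p.2 hG hl' fun e' he' =>
      mask_of_mem p.1 (hr ▸ List.mem_append_left _ he')]
  rw [h1]
  exact List.map_congr_left fun e he => congrFun (mask_of_mem p.1 (List.mem_of_mem_filter he)) a

/-! ### Independence -/

/-- Both hypotheses together make the joint law a triple product, which is then reassociated. -/
theorem indepFun_prodMk_of_indepFun {Ω α β γ : Type*} [MeasurableSpace Ω] [MeasurableSpace α]
    [MeasurableSpace β] [MeasurableSpace γ] {P : Measure Ω} [IsProbabilityMeasure P]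
    {A : Ω → α} {B : Ω → β} {C : Ω → γ} (hA : Measurable A) (hB : Measurable B)
    (hC : Measurable C) (hAB : IndepFun A B P) (hABC : IndepFun (fun ω => (A ω, B ω)) C P) :
    IndepFun A (fun ω => (B ω, C ω)) P := by
  have hBC : IndepFun B C P := hABC.comp measurable_snd measurable_id
  rw [indepFun_iff_map_prod_eq_prod_map_map hA.aemeasurable (hB.prodMk hC).aemeasurable]
  rw [indepFun_iff_map_prod_eq_prod_map_map hA.aemeasurable hB.aemeasurable] at hAB
  rw [indepFun_iff_map_prod_eq_prod_map_map hB.aemeasurable hC.aemeasurable] at hBC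
  rw [indepFun_iff_map_prod_eq_prod_map_map (hA.prodMk hB).aemeasurable hC.aemeasurable, hAB]
    at hABC
  have := Measure.isProbabilityMeasure_map (μ := P) hA.aemeasurable
  have := Measure.isProbabilityMeasure_map (μ := P) hB.aemeasurable
  have := Measure.isProbabilityMeasure_map (μ := P) hC.aemeasurable
  have h := (measurePreserving_prodAssoc (P.map A) (P.map B) (P.map C)).map_eq
  rw [← hABC, Measure.map_map MeasurableEquiv.prodAssoc.measurable ((hA.prodMk hB).prodMk hC)] at h
  rw [hBC, ← h]
  rfl

section Environment

variable {Ω : Type*} [MeasurableSpace Ω] {P : Measure Ω}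
  {ν : Fin k → Measure ℝ} {X : ℕ → Fin m → Fin k → Ω → ℝ} {U : ℕ → Fin m → Ω → Fin k}

theorem indepFun_reward_mask [IsProbabilityMeasure P] (hXU : IsEnvironment P ν X U) {l : List (ℕ × Fin m)}
    {e : ℕ × Fin m} (he : e ∉ l) (a : Fin k) :
    IndepFun (X e.1 e.2 a)
      (fun ω => (mask l (fun t w a => X t w a ω), fun t w => U t w ω)) P := by
  classical
  -- All rewards at the places in `l`, for every action. Being finite and free of the coordinate at
  -- `e`, the set is handled by `indepFun_finset`; the exploratory actions are joined afterwards.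
  let T : Finset (ℕ × Fin m × Fin k) :=
    (l.toFinset ×ˢ (Finset.univ : Finset (Fin k))).image fun q => (q.1.1, q.1.2, q.2)
  have hT : ∀ t w b, (t, w, b) ∈ T ↔ (t, w) ∈ l := fun t w b => by
    simp only [T, Finset.mem_image, Finset.mem_product, List.mem_toFinset, Finset.mem_univ,
      and_true]
    constructor
    · rintro ⟨⟨⟨t', w'⟩, b'⟩, h1, h2⟩
      simp only [Prod.mk.injEq] at h2
      obtain ⟨rfl, rfl, rfl⟩ := h2
      exact h1
    · exact fun h => ⟨((t, w), b), h, rfl⟩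
  have hd : Disjoint ({(e.1, e.2, a)} : Finset (ℕ × Fin m × Fin k)) T := by
    rw [Finset.disjoint_singleton_left, hT]
    exact he
  have hm : ∀ i : ℕ × Fin m × Fin k, Measurable (X i.1 i.2.1 i.2.2) :=
    fun i => hXU.measurable_reward _ _ _
  have h1 := hXU.indep_reward.indepFun_finset _ _ hd hm
  have hA : IndepFun (X e.1 e.2 a) (fun ω (i : T) => X i.1.1 i.1.2.1 i.1.2.2 ω) P :=
    h1.comp (φ := fun z : ({(e.1, e.2, a)} : Finset (ℕ × Fin m × Fin k)) → ℝ =>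
      z ⟨(e.1, e.2, a), Finset.mem_singleton_self _⟩) (by fun_prop) measurable_id
  have hB : IndepFun (fun ω => (X e.1 e.2 a ω, fun i : T => X i.1.1 i.1.2.1 i.1.2.2 ω))
      (fun ω (i : ℕ × Fin m) => U i.1 i.2 ω) P :=
    hXU.indep.comp (φ := fun z => (z (e.1, e.2, a), fun i : T => z i.1)) (ψ := id)
      (by fun_prop) measurable_id
  have hC := indepFun_prodMk_of_indepFun (hXU.measurable_reward _ _ _)
    (measurable_pi_lambda _ fun i : T => hm i.1)
    (measurable_pi_lambda _ fun i : ℕ × Fin m => hXU.measurable_explore i.1 i.2) hA hB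
  let ψ : (T → ℝ) × (ℕ × Fin m → Fin k) → Noise m k := fun q =>
    (fun t w b => if h : (t, w, b) ∈ T then q.1 ⟨_, h⟩ else 0, fun t w => q.2 (t, w))
  have hψ : Measurable ψ := by
    refine Measurable.prodMk (measurable_pi_lambda _ fun t => measurable_pi_lambda _ fun w =>
      measurable_pi_lambda _ fun b => ?_) (by fun_prop)
    by_cases h : (t, w, b) ∈ T
    · simp only [h, dite_true]; fun_prop
    · simp only [h, dite_false]; fun_prop
  have hfin : IndepFun (X e.1 e.2 a)
      (fun ω => ψ (fun i : T => X i.1.1 i.1.2.1 i.1.2.2 ω, fun i => U i.1 i.2 ω)) P :=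
    hC.comp measurable_id hψ
  convert hfin using 1
  funext ω
  refine Prod.ext ?_ rfl
  funext t w b
  by_cases h : (t, w) ∈ l
  · simp [mask, ψ, hT, h]
  · simp [mask, ψ, hT, h]

/-! ### The weight supermartingale along the arrivals. -/

/-- The realised noise. -/
def noise (X : ℕ → Fin m → Fin k → Ω → ℝ) (U : ℕ → Fin m → Ω → Fin k) (ω : Ω) : Noise m k :=
  (fun t w a => X t w a ω, fun t w => U t w ω)

theorem measurable_noise (hXU : IsEnvironment P ν X U) : Measurable (noise X U) :=
  (measurable_pi_lambda _ fun t => measurable_pi_lambda _ fun w => measurable_pi_lambda _ fun a =>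
    hXU.measurable_reward t w a).prodMk
  (measurable_pi_lambda _ fun t => measurable_pi_lambda _ fun w => hXU.measurable_explore t w)

theorem measurable_mask (l : List (ℕ × Fin m)) :
    Measurable fun p : Noise m k => ((mask l p.1, p.2) : Noise m k) := by
  refine Measurable.prodMk (measurable_pi_lambda _ fun t => measurable_pi_lambda _ fun w =>
    ?_) (by fun_prop)
  unfold mask
  split_ifs
  · fun_prop
  · exact measurable_const

theorem measurable_weight_arrivals (hπ : MeasurablePolicy π) (a : Fin k)
    {f : ℕ → ℝ → ENNReal} (hf : ∀ i, Measurable (f i)) (l : List (ℕ × Fin m)) :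
    Measurable fun p : Noise m k => weight f (arrivals G v π a l p) := by
  refine (fiberMeasurable_filter_action (G := G) (v := v) hπ a l).measurable_bind
    (g := fun p l' => weight f (l'.map fun e => p.1 e.1 e.2 a)) fun l' => ?_
  unfold weight
  simp only [List.length_map]
  refine Finset.measurable_prod _ fun i hi => (hf i).comp ?_
  have hi' : i < l'.length := Finset.mem_range.1 hi
  simp only [List.getD_eq_getElem?_getD, List.getElem?_map, List.getElem?_eq_getElem hi',
    Option.map_some, Option.getD_some]
  exact measurable_coord _ _ _

theorem measurable_length_arrivals (hπ : MeasurablePolicy π) (a : Fin k) (l : List (ℕ × Fin m)) :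
    FiberMeasurable fun p : Noise m k => (arrivals G v π a l p).length := by
  unfold arrivals
  simp only [List.length_map]
  exact (fiberMeasurable_filter_action hπ a l).comp List.length

/-- The supermartingale step. The masked noise decides whether `e` carries `a` and which factor
comes next, while the reward at `e` is independent of it with law `ν a`. Integrating over that
reward first multiplies the weight by at most one. -/
theorem lintegral_weight_append_le [IsProbabilityMeasure P] (hXU : IsEnvironment P ν X U) [∀ a, IsProbabilityMeasure (ν a)]
    (hG : G.Connected) (hπ : MeasurablePolicy π) {a : Fin k} {f : ℕ → ℝ → ENNReal}
    (hf : ∀ i, Measurable (f i)) (hf1 : ∀ i, ∫⁻ y, f i y ∂(ν a) ≤ 1) {n : ℕ}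
    {l₁ l₂ : List (ℕ × Fin m)} {e : ℕ × Fin m} (hl : slots G v n = l₁ ++ e :: l₂) :
    ∫⁻ ω, weight f (arrivals G v π a (l₁ ++ [e]) (noise X U ω)) ∂P
      ≤ ∫⁻ ω, weight f (arrivals G v π a l₁ (noise X U ω)) ∂P := by
  have he : e ∉ l₁ := by
    have h := nodup_slots G v n
    rw [hl, List.nodup_append'] at h
    exact fun h' => h.2.2 h' List.mem_cons_self
  set Y : Ω → Noise m k := fun ω => (mask l₁ (noise X U ω).1, (noise X U ω).2) with hY
  have hYm : Measurable Y := (measurable_mask l₁).comp (measurable_noise hXU)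
  let h : Noise m k → ℝ → ENNReal := fun p y => weight f (arrivals G v π a l₁ p) *
    if action G v π p.1 p.2 e.1 e.2 = a then f (arrivals G v π a l₁ p).length y else 1
  have hW := measurable_weight_arrivals (G := G) (v := v) hπ a hf l₁
  have hm : Measurable fun q : ℝ × Noise m k => h q.2 q.1 := by
    refine (hW.comp measurable_snd).mul ?_
    have hb : FiberMeasurable fun q : ℝ × Noise m k =>
        (action G v π q.2.1 q.2.2 e.1 e.2, (arrivals G v π a l₁ q.2).length) := by
      intro b
      have : (fun q : ℝ × Noise m k =>
          (action G v π q.2.1 q.2.2 e.1 e.2, (arrivals G v π a l₁ q.2).length)) ⁻¹' {b}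
        = Prod.snd ⁻¹' (((fun p : Noise m k => action G v π p.1 p.2 e.1 e.2) ⁻¹' {b.1})
          ∩ ((fun p => (arrivals G v π a l₁ p).length) ⁻¹' {b.2})) := by
        ext q; simp [Prod.ext_iff]
      rw [this]
      exact measurable_snd ((fiberMeasurable_action hπ _ _ _).inter
        (measurable_length_arrivals hπ a l₁ _))
    refine hb.measurable_bind (g := fun q b => if b.1 = a then f b.2 q.1 else 1) fun b => ?_
    split_ifs
    · exact (hf _).comp measurable_fst
    · exact measurable_const
  have hlaw : P.map (fun ω => (X e.1 e.2 a ω, Y ω)) = (ν a).prod (P.map Y) := by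
    rw [← hXU.map_reward e.1 e.2 a]
    exact (indepFun_iff_map_prod_eq_prod_map_map (hXU.measurable_reward _ _ _).aemeasurable
      hYm.aemeasurable).1 (indepFun_reward_mask hXU he a)
  have := Measure.isProbabilityMeasure_map (μ := P) hYm.aemeasurable
  calc ∫⁻ ω, weight f (arrivals G v π a (l₁ ++ [e]) (noise X U ω)) ∂P
      = ∫⁻ ω, h (Y ω) (X e.1 e.2 a ω) ∂P := by
        refine lintegral_congr fun ω => ?_
        simp only [h, hY]
        rw [arrivals_mask hG hl, action_mask hG hl, arrivals_append]
        split_ifs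
        · rw [weight_append]; rfl
        · rw [List.append_nil, mul_one]
    _ = ∫⁻ q, h q.2 q.1 ∂((ν a).prod (P.map Y)) := by
        rw [← hlaw, lintegral_map hm ((hXU.measurable_reward _ _ _).prodMk hYm)]
    _ = ∫⁻ p, ∫⁻ y, h p y ∂(ν a) ∂(P.map Y) := lintegral_prod_symm' _ hm
    _ ≤ ∫⁻ p, weight f (arrivals G v π a l₁ p) ∂(P.map Y) := by
        refine lintegral_mono fun p => ?_
        simp only [h]
        split_ifs
        · rw [lintegral_const_mul _ (hf _)]
          exact mul_le_of_le_one_right' (hf1 _)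
        · simp
    _ = ∫⁻ ω, weight f (arrivals G v π a l₁ (noise X U ω)) ∂P := by
        rw [lintegral_map hW hYm]
        exact lintegral_congr fun ω => by rw [hY, arrivals_mask hG hl]

theorem lintegral_weight_le_one [IsProbabilityMeasure P] (hXU : IsEnvironment P ν X U) [∀ a, IsProbabilityMeasure (ν a)]
    (hG : G.Connected) (hπ : MeasurablePolicy π) {a : Fin k} {f : ℕ → ℝ → ENNReal}
    (hf : ∀ i, Measurable (f i)) (hf1 : ∀ i, ∫⁻ y, f i y ∂(ν a) ≤ 1) {n : ℕ}
    {l₁ l₂ : List (ℕ × Fin m)} (hl : slots G v n = l₁ ++ l₂) :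
    ∫⁻ ω, weight f (arrivals G v π a l₁ (noise X U ω)) ∂P ≤ 1 := by
  induction l₁ using List.reverseRecOn generalizing l₂ with
  | nil => simp [arrivals, weight]
  | append_singleton l e ih =>
    have hcons : slots G v n = l ++ e :: l₂ := by rw [hl]; simp
    exact (lintegral_weight_append_le hXU hG hπ hf hf1 hcons).trans (ih hcons)

/-- Deviation of the truncated mean of the first `s` rewards of `a` that reach the leader. -/
theorem measure_deviation_le [IsProbabilityMeasure P] (hXU : IsEnvironment P ν X U) [∀ a, IsProbabilityMeasure (ν a)]
    (hG : G.Connected) (hπ : MeasurablePolicy π) {ε σ : ℝ} (hε : 0 < ε) (hε1 : ε ≤ 1)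
    (hσ : 0 < σ) {a : Fin k} (hint : Integrable (fun x : ℝ => |x| ^ (1 + ε)) (ν a))
    (hmom : ∫ x, |x| ^ (1 + ε) ∂(ν a) ≤ σ) {δ κ : ℝ} (hδ0 : 0 < δ) (hδ : 0 < Real.log (1 / δ))
    (hκ : |κ| = 1) {s : ℕ} (hs : s ≠ 0) (n : ℕ) :
    P {ω | s ≤ (arrivals G v π a (slots G v n) (noise X U ω)).length ∧
      4 * width ε σ (Real.log (1 / δ)) s
        ≤ κ * (truncatedMean ε σ δ ((arrivals G v π a (slots G v n) (noise X U ω)).take s)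
          - mean ν a)} ≤ ENNReal.ofReal δ := by
  obtain ⟨f, hf, hf1, hdev⟩ := exists_weight hε hε1 hσ hint hmom hδ0 hδ hκ hs
  have hW : Measurable fun ω => weight f (arrivals G v π a (slots G v n) (noise X U ω)) :=
    (measurable_weight_arrivals hπ a hf _).comp (measurable_noise hXU)
  have hpos : 0 < 1 / δ := one_div_pos.2 hδ0
  calc _ ≤ P {ω | ENNReal.ofReal (1 / δ)
        ≤ weight f (arrivals G v π a (slots G v n) (noise X U ω))} :=
        measure_mono fun ω hω => hdev _ hω.1 hω.2
    _ ≤ (∫⁻ ω, weight f (arrivals G v π a (slots G v n) (noise X U ω)) ∂P)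
        / ENNReal.ofReal (1 / δ) :=
        meas_ge_le_lintegral_div hW.aemeasurable (by simpa using hδ0) ENNReal.ofReal_ne_top
    _ ≤ 1 / ENNReal.ofReal (1 / δ) := by
        gcongr
        exact lintegral_weight_le_one hXU hG hπ hf hf1 (List.append_nil _).symm
    _ = ENNReal.ofReal δ := by
        rw [one_div, ← ENNReal.ofReal_inv_of_pos hpos, one_div, inv_inv]

end Environment

end Sampling

section Regret

variable {m k : ℕ}

/-! ### Gaps -/

theorem gap_nonneg (ν : Fin k → Measure ℝ) (a : Fin k) : 0 ≤ gap ν a :=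
  sub_nonneg.2 (le_ciSup (Set.finite_range _).bddAbove a)

theorem mem_subopt {ν : Fin k → Measure ℝ} {a : Fin k} : a ∈ subopt ν ↔ 0 < gap ν a := by
  simp [subopt]

theorem exists_best (ν : Fin k → Measure ℝ) (a : Fin k) :
    ∃ b, mean ν b = mean ν a + gap ν a := by
  have : Nonempty (Fin k) := ⟨a⟩
  obtain ⟨b, hb⟩ := exists_eq_ciSup_of_finite (f := mean ν)
  exact ⟨b, by rw [hb, gap]; ring⟩

theorem abs_mean_le {ν : Measure ℝ} [IsProbabilityMeasure ν] {ε σ B : ℝ} (hε : 0 < ε)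
    (hB : 0 < B) (hint : Integrable (fun x : ℝ => |x| ^ (1 + ε)) ν)
    (hmom : ∫ x, |x| ^ (1 + ε) ∂ν ≤ σ) : |∫ x, x ∂ν| ≤ B + σ / B ^ ε := by
  have h1 := abs_mean_sub_trunc_le hε hB hint hmom
  have h2 : |∫ x, trunc B x ∂ν| ≤ B := by
    have := norm_integral_le_of_norm_le_const (μ := ν) (f := trunc B)
      (Filter.Eventually.of_forall fun x => abs_trunc_le hB.le x)
    simpa using this
  rw [abs_le] at h1 h2 ⊢
  constructor <;> linarith

variable {ε σ : ℝ} {ν : Fin k → Measure ℝ}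

/-- Two means, each bounded by truncation at `B`; the freedom in `B` serves both of the next two
lemmas. -/
theorem gap_le [∀ a, IsProbabilityMeasure (ν a)] (hε : 0 < ε)
    (hint : ∀ a, Integrable (fun x : ℝ => |x| ^ (1 + ε)) (ν a))
    (hmom : ∀ a, ∫ x, |x| ^ (1 + ε) ∂(ν a) ≤ σ) (a : Fin k) {B : ℝ} (hB : 0 < B) :
    gap ν a ≤ 2 * (B + σ / B ^ ε) := by
  obtain ⟨b, hb⟩ := exists_best ν a
  have h1 := abs_le.1 (abs_mean_le hε hB (hint a) (hmom a))
  have h2 := abs_le.1 (abs_mean_le hε hB (hint b) (hmom b))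
  unfold mean at hb
  linarith

theorem pos_of_gap_pos [∀ a, IsProbabilityMeasure (ν a)] (hε : 0 < ε)
    (hint : ∀ a, Integrable (fun x : ℝ => |x| ^ (1 + ε)) (ν a))
    (hmom : ∀ a, ∫ x, |x| ^ (1 + ε) ∂(ν a) ≤ σ) {a : Fin k} (ha : 0 < gap ν a) : 0 < σ := by
  by_contra hσ
  -- If `σ ≤ 0`, this choice gives `gap ≤ gap / 2`.
  have h := gap_le hε hint hmom a (B := gap ν a / 4) (by positivity)
  have : σ / (gap ν a / 4) ^ ε ≤ 0 := div_nonpos_of_nonpos_of_nonneg (not_lt.1 hσ) (by positivity)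
  linarith

theorem gap_le_moment [∀ a, IsProbabilityMeasure (ν a)] (hε : 0 < ε) (hσ : 0 < σ)
    (hint : ∀ a, Integrable (fun x : ℝ => |x| ^ (1 + ε)) (ν a))
    (hmom : ∀ a, ∫ x, |x| ^ (1 + ε) ∂(ν a) ≤ σ) (a : Fin k) :
    gap ν a ≤ 4 * σ ^ (1 / (1 + ε)) := by
  -- The level at which both terms of the bound coincide.
  have h := gap_le hε hint hmom a (B := σ ^ (1 / (1 + ε))) (by positivity)
  have h1 : σ / (σ ^ (1 / (1 + ε))) ^ ε = σ ^ (1 / (1 + ε)) := by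
    rw [← Real.rpow_mul hσ.le]
    nth_rewrite 1 [← Real.rpow_one σ]
    rw [← Real.rpow_sub hσ]
    congr 1
    field_simp
    ring
  rw [h1] at h
  linarith

/-! ### Selections of the robust upper confidence bound algorithm -/

/-- Among the first `t - 1` prefixes of `xs` there is one whose truncated mean deviates, in the
direction `κ`, from `μ` by the exploration bonus of round `t`. -/
def Deviates (ε σ κ μ : ℝ) (t : ℕ) (xs : List ℝ) : Prop :=
  ∃ s ∈ Finset.Ico 1 t, s ≤ xs.length ∧
    4 * width ε σ (Real.log (1 / (1 / (t : ℝ) ^ 2))) s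
      ≤ κ * (truncatedMean ε σ (1 / (t : ℝ) ^ 2) (xs.take s) - μ)

theorem length_samples_le (h : List (Fin k × ℝ)) (a : Fin k) : (samples h a).length ≤ h.length :=
  List.length_filterMap_le _ _

/-- Without deviations the index of `a` is below `mean ν a + 8 * width`, hence below `mean ν b`,
which is below the index of `b`. Enlarging the samples to `xa` and `xb` lets the random sample
counts be covered by a union over prefix lengths. -/
theorem deviates_or_deviates_of_select {π : List (Fin k × ℝ) → Fin k} (hπ : IsRobustUCB ε σ π)
    {h : List (Fin k × ℝ)} {a b : Fin k} (hab : π h = a) (hs : (samples h a).length ≠ 0)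
    (hmean : mean ν b = mean ν a + gap ν a)
    (hw : 8 * width ε σ (Real.log (1 / (1 / ((h.length + 1 : ℕ) : ℝ) ^ 2))) (samples h a).length
      < gap ν a) {xa xb : List ℝ} (ha : samples h a <+: xa) (hb : samples h b <+: xb) :
    Deviates ε σ 1 (mean ν a) (h.length + 1) xa ∨
      Deviates ε σ (-1) (mean ν b) (h.length + 1) xb := by
  have hidx := hπ h b
  rw [hab] at hidx
  unfold robustIndex at hidx
  simp only [hs, if_false] at hidx
  by_cases hsb : (samples h b).length = 0
  · rw [if_pos hsb] at hidx
    exact absurd hidx (not_le.2 (EReal.coe_lt_top _))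
  rw [if_neg hsb, EReal.coe_le_coe_iff] at hidx
  have hlog : Real.log (1 / (1 / ((h.length + 1 : ℕ) : ℝ) ^ 2))
      = Real.log (((h.length : ℝ) + 1) ^ 2) := by simp
  have hcast : ((h.length + 1 : ℕ) : ℝ) = (h.length : ℝ) + 1 := by push_cast; rfl
  have hbonus : ∀ s : ℕ, 4 * σ ^ (1 / (1 + ε)) *
      (Real.log (((h.length : ℝ) + 1) ^ 2) / s) ^ (ε / (1 + ε))
        = 4 * width ε σ (Real.log (1 / (1 / ((h.length + 1 : ℕ) : ℝ) ^ 2))) s := fun s => by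
    rw [hlog, width]; ring
  rw [hbonus, hbonus] at hidx
  by_contra hcon
  rw [not_or] at hcon
  obtain ⟨h1, h2⟩ := hcon
  have h3 := not_le.1 fun hle => h1 ⟨(samples h a).length,
    Finset.mem_Ico.2 ⟨by omega, Nat.lt_succ_of_le (length_samples_le h a)⟩, ha.length_le, hle⟩
  have h4 := not_le.1 fun hle => h2 ⟨(samples h b).length,
    Finset.mem_Ico.2 ⟨by omega, Nat.lt_succ_of_le (length_samples_le h b)⟩, hb.length_le, hle⟩
  rw [← List.prefix_iff_eq_take.1 ha, hcast] at h3
  rw [← List.prefix_iff_eq_take.1 hb, hcast] at h4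
  rw [hcast] at hidx hw
  linarith

theorem eight_mul_width_lt (hε : 0 < ε) (hσ : 0 < σ) {L M Δ : ℝ} (hL : 0 ≤ L) (hLM : L ≤ M)
    (hΔ : 0 < Δ) {s : ℕ} (hs : M * (8 * σ ^ (1 / (1 + ε)) / Δ) ^ ((1 + ε) / ε) < s) :
    8 * width ε σ L s < Δ := by
  set K := 8 * σ ^ (1 / (1 + ε)) / Δ with hK
  have hK0 : 0 < K := by positivity
  have hs0 : (0 : ℝ) < s := lt_of_le_of_lt (mul_nonneg (hL.trans hLM) (by positivity)) hs
  have h1 : L / s < K⁻¹ ^ ((1 + ε) / ε) := by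
    rw [Real.inv_rpow hK0.le, div_lt_iff₀ hs0, inv_mul_eq_div, lt_div_iff₀ (by positivity)]
    exact (mul_le_mul_of_nonneg_right hLM (by positivity)).trans_lt hs
  have h2 : (L / s) ^ (ε / (1 + ε)) < K⁻¹ := by
    have h := Real.rpow_lt_rpow (by positivity) h1 (show 0 < ε / (1 + ε) by positivity)
    rwa [← Real.rpow_mul (by positivity),
      show (1 + ε) / ε * (ε / (1 + ε)) = 1 by field_simp, Real.rpow_one] at h
  have h3 : 8 * σ ^ (1 / (1 + ε)) = K * Δ := by rw [hK]; field_simp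
  unfold width
  rw [← mul_assoc, h3]
  calc K * Δ * (L / s) ^ (ε / (1 + ε)) < K * Δ * K⁻¹ := by gcongr
    _ = Δ := by field_simp

/-- Number of samples of a suboptimal action in terms of the deviations. -/
theorem length_samples_take_le {π : List (Fin k × ℝ) → Fin k} (hπ : IsRobustUCB ε σ π)
    (hε : 0 < ε) (hσ : 0 < σ) {h : List (Fin k × ℝ)} (hfol : Follows π h) {N : ℕ}
    (hN : h.length ≤ N) {a b : Fin k} (hgap : 0 < gap ν a)
    (hmean : mean ν b = mean ν a + gap ν a) {xa xb : List ℝ} (ha : samples h a <+: xa)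
    (hb : samples h b <+: xb) {φ : ℕ → ℝ} (hφ0 : ∀ t, 0 ≤ φ t)
    (hφ : ∀ t, Deviates ε σ 1 (mean ν a) t xa ∨ Deviates ε σ (-1) (mean ν b) t xb → 1 ≤ φ t)
    {i : ℕ} (hi : i ≤ h.length) :
    ((samples (h.take i) a).length : ℝ)
      ≤ 2 * Real.log N * (8 * σ ^ (1 / (1 + ε)) / gap ν a) ^ ((1 + ε) / ε) + 1
        + ∑ t ∈ Finset.Ico 2 (i + 1), φ t := by
  set s₀ := 2 * Real.log N * (8 * σ ^ (1 / (1 + ε)) / gap ν a) ^ ((1 + ε) / ε) with hs₀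
  have hs₀0 : 0 ≤ s₀ :=
    mul_nonneg (mul_nonneg zero_le_two (Real.log_natCast_nonneg N)) (by positivity)
  induction i with
  | zero => simp [samples]; linarith
  | succ i ih =>
    have hi' : i < h.length := hi
    have ih := ih hi'.le
    have hsum : ∑ t ∈ Finset.Ico 2 (i + 1), φ t ≤ ∑ t ∈ Finset.Ico 2 (i + 1 + 1), φ t :=
      Finset.sum_le_sum_of_subset_of_nonneg (Finset.Ico_subset_Ico le_rfl (by omega))
        fun t _ _ => hφ0 t
    have htake : samples (h.take (i + 1)) a
        = samples (h.take i) a ++ if h[i].1 = a then [h[i].2] else [] := by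
      rw [List.take_succ_eq_append_getElem hi']
      exact (tagSamples_append _ _ a).trans (by rw [tagSamples_singleton]; rfl)
    rw [htake]
    by_cases hia : h[i].1 = a
    swap
    · rw [if_neg hia, List.append_nil]
      linarith
    rw [if_pos hia, List.length_append, List.length_singleton]
    push_cast
    set s := (samples (h.take i) a).length with hs
    -- Up to `s₀` samples the bound holds outright, with `+ 1` for the new one. Beyond that the
    -- selection in round `i + 1` forces `φ (i + 1) ≥ 1`; since `a` then has a sample, this round is
    -- at least the second.
    by_cases hle : (s : ℝ) ≤ s₀
    · have := Finset.sum_nonneg fun t (_ : t ∈ Finset.Ico 2 (i + 1 + 1)) => hφ0 t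
      linarith
    rw [not_le] at hle
    have hspos : s ≠ 0 := by
      rintro h0
      rw [h0, Nat.cast_zero] at hle
      linarith
    have hlen : (h.take i).length = i := by simp; omega
    have hi1 : 1 ≤ i := by
      have := length_samples_le (h.take i) a
      omega
    have hpre : ∀ c, samples (h.take i) c <+: samples h c := fun c =>
      (List.take_prefix i h).filterMap _
    have hcast : (1 : ℝ) ≤ ((i + 1 : ℕ) : ℝ) := by exact_mod_cast Nat.le_add_left 1 i
    have hw : 8 * width ε σ (Real.log (1 / (1 / (((h.take i).length + 1 : ℕ) : ℝ) ^ 2))) s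
        < gap ν a := by
      rw [hlen, one_div_one_div, Real.log_pow]
      refine eight_mul_width_lt hε hσ (mul_nonneg (by norm_num) (Real.log_nonneg hcast)) ?_ hgap hle
      push_cast
      gcongr
      · exact_mod_cast hi.trans hN
    have hdev := deviates_or_deviates_of_select hπ
      (by rw [← hfol i hi', hia]) hspos hmean hw ((hpre a).trans ha) ((hpre b).trans hb)
    rw [hlen] at hdev
    rw [Finset.sum_Ico_succ_top (by omega)]
    have := hφ _ hdev
    linarith

theorem sum_inv_le_log {N : ℕ} (hN : 1 ≤ N) :
    ∑ t ∈ Finset.Ico 2 (N + 1), 1 / (t : ℝ) ≤ Real.log N := by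
  have h := harmonic_le_one_add_log N
  rw [harmonic_eq_sum_Icc, ← Finset.Ico_add_one_right_eq_Icc,
    Finset.sum_eq_sum_Ico_succ_bot (by omega)] at h
  push_cast at h
  simp only [one_div]
  norm_num at h
  exact h

section Environment

variable {Ω : Type*} [MeasurableSpace Ω] {P : Measure Ω} [IsProbabilityMeasure P]
  [∀ a, IsProbabilityMeasure (ν a)]
  {X : ℕ → Fin m → Fin k → Ω → ℝ} {U : ℕ → Fin m → Ω → Fin k}
  {G : SimpleGraph (Fin m)} {v : Fin m} {π : List (Fin k × ℝ) → Fin k}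

/-- Fewer than `t` prefix lengths, each of probability at most `1 / t ^ 2`. -/
theorem measureReal_deviates_le (hXU : IsEnvironment P ν X U) (hG : G.Connected)
    (hπ : MeasurablePolicy π) (hε : 0 < ε) (hε1 : ε ≤ 1) (hσ : 0 < σ) {a : Fin k}
    (hint : Integrable (fun x : ℝ => |x| ^ (1 + ε)) (ν a))
    (hmom : ∫ x, |x| ^ (1 + ε) ∂(ν a) ≤ σ) {κ : ℝ} (hκ : |κ| = 1) (n : ℕ) {t : ℕ} (ht : 2 ≤ t) :
    P.real {ω | Deviates ε σ κ (mean ν a) t (arrivals G v π a (slots G v n) (noise X U ω))}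
      ≤ 1 / t := by
  have ht2 : (2 : ℝ) ≤ t := by exact_mod_cast ht
  have ht0 : (0 : ℝ) < 1 / (t : ℝ) ^ 2 := by positivity
  have hlog : 0 < Real.log (1 / (1 / (t : ℝ) ^ 2)) := by
    rw [one_div_one_div]
    apply Real.log_pos
    nlinarith
  have hsub : {ω | Deviates ε σ κ (mean ν a) t (arrivals G v π a (slots G v n) (noise X U ω))}
      ⊆ ⋃ s ∈ Finset.Ico 1 t, {ω | s ≤ (arrivals G v π a (slots G v n) (noise X U ω)).length ∧
        4 * width ε σ (Real.log (1 / (1 / (t : ℝ) ^ 2))) s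
          ≤ κ * (truncatedMean ε σ (1 / (t : ℝ) ^ 2)
            ((arrivals G v π a (slots G v n) (noise X U ω)).take s) - mean ν a)} := by
    rintro ω ⟨s, hs, h⟩
    exact Set.mem_biUnion hs h
  refine (measureReal_mono hsub (measure_ne_top _ _)).trans ((measureReal_biUnion_finset_le _ _).trans ?_)
  calc _ ≤ ∑ _s ∈ Finset.Ico 1 t, 1 / (t : ℝ) ^ 2 := by
        refine Finset.sum_le_sum fun s hs => ?_
        have hs1 := (Finset.mem_Ico.1 hs).1
        exact ENNReal.toReal_le_of_le_ofReal ht0.le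
          (measure_deviation_le hXU hG hπ hε hε1 hσ hint hmom ht0 hlog hκ (by omega) n)
    _ = ((t - 1 : ℕ) : ℝ) * (1 / (t : ℝ) ^ 2) := by simp
    _ ≤ t * (1 / (t : ℝ) ^ 2) := by
        gcongr
        omega
    _ = 1 / t := by field_simp

/-- Expected number of plays of a suboptimal action in the whole network. -/
theorem integral_plays_le (hXU : IsEnvironment P ν X U) (hG : G.Connected)
    (hπm : MeasurablePolicy π) (hπ : IsRobustUCB ε σ π) (hε : 0 < ε) (hε1 : ε ≤ 1) (hσ : 0 < σ)
    (hint : ∀ a, Integrable (fun x : ℝ => |x| ^ (1 + ε)) (ν a))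
    (hmom : ∀ a, ∫ x, |x| ^ (1 + ε) ∂(ν a) ≤ σ) {n : ℕ} (hmn : 1 ≤ m * n) {a : Fin k}
    (hgap : 0 < gap ν a) :
    ∫ ω, ∑ w, (plays G v π (fun t w a => X t w a ω) (fun t w => U t w ω) n w a : ℝ) ∂P
      ≤ 2 * Real.log ((m * n : ℕ) : ℝ) * (8 * σ ^ (1 / (1 + ε)) / gap ν a) ^ ((1 + ε) / ε) + 1
        + 2 * Real.log ((m * n : ℕ) : ℝ) + 2 * ∑ w, (G.dist v w : ℝ) := by
  obtain ⟨b, hb⟩ := exists_best ν a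
  set N := m * n with hNdef
  set s₀ := 2 * Real.log (N : ℝ) * (8 * σ ^ (1 / (1 + ε)) / gap ν a) ^ ((1 + ε) / ε) with hs₀
  -- Measurable hulls have the same measure and spare a proof that the deviation events are
  -- measurable.
  set F : ℕ → Set Ω := fun t => toMeasurable P
    {ω | Deviates ε σ 1 (mean ν a) t (arrivals G v π a (slots G v n) (noise X U ω))} with hF
  set F' : ℕ → Set Ω := fun t => toMeasurable P
    {ω | Deviates ε σ (-1) (mean ν b) t (arrivals G v π b (slots G v n) (noise X U ω))} with hF'
  have hFm : ∀ t, MeasurableSet (F t) := fun t => measurableSet_toMeasurable _ _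
  have hF'm : ∀ t, MeasurableSet (F' t) := fun t => measurableSet_toMeasurable _ _
  set φ : ℕ → Ω → ℝ := fun t ω => (F t).indicator 1 ω + (F' t).indicator 1 ω with hφ
  have hφ0 : ∀ t ω, 0 ≤ φ t ω := fun t ω =>
    add_nonneg (Set.indicator_nonneg (fun _ _ => zero_le_one) _)
      (Set.indicator_nonneg (fun _ _ => zero_le_one) _)
  have hind : ∀ {S : Set Ω}, MeasurableSet S → Integrable (S.indicator (1 : Ω → ℝ)) P := fun hS =>
    (integrable_const (1 : ℝ)).indicator hS
  have hφi : ∀ t, Integrable (φ t) P := fun t => (hind (hFm t)).add (hind (hF'm t))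
  have hφint : ∀ t ∈ Finset.Ico 2 (N + 1), ∫ ω, φ t ω ∂P ≤ 2 * (1 / (t : ℝ)) := by
    intro t ht
    have ht2 := (Finset.mem_Ico.1 ht).1
    rw [integral_add (hind (hFm t)) (hind (hF'm t)), integral_indicator_one (hFm t),
      integral_indicator_one (hF'm t)]
    have h1 := measureReal_deviates_le hXU hG hπm hε hε1 hσ (hint a) (hmom a) (κ := 1) (v := v)
      (by simp) n ht2
    have h2 := measureReal_deviates_le hXU hG hπm hε hε1 hσ (hint b) (hmom b) (κ := -1) (v := v)
      (by simp) n ht2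
    simp only [Measure.real, hF, hF', measure_toMeasurable] at h1 h2 ⊢
    linarith
  have hpoint : ∀ ω,
      ∑ w, (plays G v π (fun t w a => X t w a ω) (fun t w => U t w ω) n w a : ℝ)
        ≤ s₀ + 1 + 2 * ∑ w, (G.dist v w : ℝ) + ∑ t ∈ Finset.Ico 2 (N + 1), φ t ω := by
    intro ω
    set p := noise X U ω with hp
    set h := (tagRun G v π p.1 p.2 n).hist with hh
    set hr : List (Fin k × ℝ) := h.map fun q => (q.1, p.1 q.2.1 q.2.2 q.1) with hhr
    have hfol : Follows π hr := by
      intro i hi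
      have hi' : i < h.length := by simpa [hhr] using hi
      have := tagRun_follows G v π p.1 p.2 n i hi'
      simp only [hhr, List.getElem_map, ← List.map_take]
      exact this
    have hlen : hr.length ≤ N := by
      rw [hhr, List.length_map]
      exact length_hist_le π p.1 p.2 hG n
    have hpre : ∀ c, samples hr c <+: arrivals G v π c (slots G v n) p := fun c => by
      unfold arrivals
      rw [← samples_append_queue π p.1 p.2 hG, hhr, samples_map, List.map_append]
      exact List.prefix_append _ _
    have hmain := length_samples_take_le hπ hε hσ hfol hlen hgap hb (hpre a) (hpre b)
      (φ := fun t => φ t ω) (fun t => hφ0 t ω) (fun t ht => ?_) le_rfl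
    · have hsum : ∑ w, (plays G v π p.1 p.2 n w a : ℝ)
          ≤ (samples hr a).length + 2 * ∑ w, (G.dist v w : ℝ) := by
        have := sum_plays_le (v := v) π p.1 p.2 hG n a
        rw [hhr, samples_map, List.length_map]
        exact_mod_cast this
      rw [List.take_length] at hmain
      have hmono : ∑ t ∈ Finset.Ico 2 (hr.length + 1), φ t ω
          ≤ ∑ t ∈ Finset.Ico 2 (N + 1), φ t ω :=
        Finset.sum_le_sum_of_subset_of_nonneg (Finset.Ico_subset_Ico le_rfl (by omega))
          fun t _ _ => hφ0 t ω
      change ∑ w, (plays G v π p.1 p.2 n w a : ℝ) ≤ _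
      linarith
    · rcases ht with ht | ht
      · have : ω ∈ F t := subset_toMeasurable _ _ ht
        simp only [hφ, Set.indicator_of_mem this, Pi.one_apply]
        have := Set.indicator_nonneg (s := F' t) (f := (1 : Ω → ℝ)) (fun _ _ => zero_le_one) ω
        linarith
      · have : ω ∈ F' t := subset_toMeasurable _ _ ht
        simp only [hφ, Set.indicator_of_mem this, Pi.one_apply]
        have := Set.indicator_nonneg (s := F t) (f := (1 : Ω → ℝ)) (fun _ _ => zero_le_one) ω
        linarith
  have hsumi : Integrable (fun ω => ∑ t ∈ Finset.Ico 2 (N + 1), φ t ω) P :=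
    integrable_finsetSum _ fun t _ => hφi t
  calc _ ≤ ∫ ω, (s₀ + 1 + 2 * ∑ w, (G.dist v w : ℝ) + ∑ t ∈ Finset.Ico 2 (N + 1), φ t ω) ∂P :=
        -- Only the dominating function has to be integrable.
        integral_mono_of_nonneg
          (Filter.Eventually.of_forall fun ω => Finset.sum_nonneg fun w _ => Nat.cast_nonneg _)
          ((integrable_const _).add hsumi) (Filter.Eventually.of_forall hpoint)
    _ = s₀ + 1 + 2 * ∑ w, (G.dist v w : ℝ) + ∑ t ∈ Finset.Ico 2 (N + 1), ∫ ω, φ t ω ∂P := by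
        rw [integral_add (integrable_const _) hsumi, integral_finsetSum _ fun t _ => hφi t]
        simp
    _ ≤ s₀ + 1 + 2 * ∑ w, (G.dist v w : ℝ) + 2 * Real.log N := by
        gcongr
        refine (Finset.sum_le_sum hφint).trans ?_
        rw [← Finset.mul_sum]
        gcongr
        exact sum_inv_le_log hmn
    _ = _ := by ring

end Environment

/-! ### From play counts to regret. -/

theorem mul_rpow_div_eq (hε : 0 < ε) (hσ : 0 < σ) {Δ c : ℝ} (hΔ : 0 < Δ) (hc : 0 < c) :
    Δ * (c * σ ^ (1 / (1 + ε)) / Δ) ^ ((1 + ε) / ε)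
      = c ^ ((1 + ε) / ε) * (σ ^ (1 / ε) / Δ ^ (1 / ε)) := by
  rw [Real.div_rpow (by positivity) hΔ.le, Real.mul_rpow hc.le (by positivity),
    ← Real.rpow_mul hσ.le, show 1 / (1 + ε) * ((1 + ε) / ε) = 1 / ε by field_simp,
    show (1 + ε) / ε = 1 / ε + 1 by field_simp, Real.rpow_add hΔ, Real.rpow_one]
  field_simp

/-- With `E = 8 ^ ((1 + ε) / ε)`, the main term gives `2 * E`. The remainder `1 + 2 * ℓ ≤ 4 * ℓ`
gives `4 * E`, because `Δ ≤ E * R` for gaps below the moment scale. The delay gives the final 2. -/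
theorem gap_mul_le (hε : 0 < ε) (hσ : 0 < σ) {Δ ℓ D : ℝ} (hΔ : 0 < Δ)
    (hΔσ : Δ ≤ 4 * σ ^ (1 / (1 + ε))) (hℓ : 1 ≤ 2 * ℓ) (hD : 0 ≤ D) :
    Δ * (2 * ℓ * (8 * σ ^ (1 / (1 + ε)) / Δ) ^ ((1 + ε) / ε) + 1 + 2 * ℓ + 2 * D)
      ≤ (6 * 8 ^ ((1 + ε) / ε) + 2) * (σ ^ (1 / ε) * ℓ / Δ ^ (1 / ε) + D * Δ) := by
  have h8 := mul_rpow_div_eq hε hσ hΔ (c := 8) (by norm_num)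
  have h4 := mul_rpow_div_eq hε hσ hΔ (c := 4) (by norm_num)
  set R := σ ^ (1 / ε) / Δ ^ (1 / ε) with hR
  have hR0 : 0 < R := by positivity
  have h1 : Δ ≤ 4 ^ ((1 + ε) / ε) * R := by
    rw [← h4]
    refine le_mul_of_one_le_right hΔ.le (Real.one_le_rpow ?_ (by positivity))
    rwa [one_le_div hΔ]
  have h48 : (4 : ℝ) ^ ((1 + ε) / ε) ≤ 8 ^ ((1 + ε) / ε) :=
    Real.rpow_le_rpow (by norm_num) (by norm_num) (by positivity)
  set E : ℝ := 8 ^ ((1 + ε) / ε) with hE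
  have hE0 : 0 < E := by positivity
  have h2 : Δ ≤ E * R := h1.trans (by gcongr)
  have hℓ0 : 0 < ℓ := by linarith
  have h3 : Δ * (1 + 2 * ℓ) ≤ E * R * (4 * ℓ) := by
    apply mul_le_mul h2 (by linarith) (by linarith) (by positivity)
  have h5 : σ ^ (1 / ε) * ℓ / Δ ^ (1 / ε) = R * ℓ := by rw [hR]; ring
  rw [h5]
  calc Δ * (2 * ℓ * (8 * σ ^ (1 / (1 + ε)) / Δ) ^ ((1 + ε) / ε) + 1 + 2 * ℓ + 2 * D)
      = 2 * ℓ * (Δ * (8 * σ ^ (1 / (1 + ε)) / Δ) ^ ((1 + ε) / ε)) + Δ * (1 + 2 * ℓ)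
        + 2 * (D * Δ) := by ring
    _ ≤ 2 * ℓ * (E * R) + E * R * (4 * ℓ) + 2 * (D * Δ) := by rw [h8]; gcongr
    _ ≤ (6 * E + 2) * (R * ℓ + D * Δ) := by
        have e1 : 0 ≤ R * ℓ := by positivity
        have e2 : 0 ≤ E * (D * Δ) := by positivity
        linarith

end Regret

end Quack

end

theorem mainTheorem3 (ε : ℝ) (hε : 0 < ε) (hε1 : ε ≤ 1) :
    ∃ C : ℝ, 0 < C ∧
      ∀ (Ω : Type*) [MeasurableSpace Ω] (P : Measure Ω) [IsProbabilityMeasure P]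
        (m k n : ℕ) (_hmn : 2 ≤ m * n)
        (G : SimpleGraph (Fin m)) (_hG : G.Connected) (v : Fin m)
        (σ : ℝ) (ν : Fin k → Measure ℝ) [∀ a, IsProbabilityMeasure (ν a)]
        (_hint : ∀ a, Integrable (fun x : ℝ => |x| ^ (1 + ε)) (ν a))
        (_hmom : ∀ a, ∫ x, |x| ^ (1 + ε) ∂(ν a) ≤ σ)
        (X : ℕ → Fin m → Fin k → Ω → ℝ) (U : ℕ → Fin m → Ω → Fin k)
        (_hXU : Quack.IsEnvironment P ν X U)
        (π : List (Fin k × ℝ) → Fin k) (_hπm : Quack.MeasurablePolicy π)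
        (_hπ : Quack.IsRobustUCB ε σ π),
        Quack.groupRegret P ν X U G v π n ≤
          C * ((∑ a ∈ Quack.subopt ν,
                  σ ^ (1 / ε) * Real.log ((m : ℝ) * n) / Quack.gap ν a ^ (1 / ε))
              + (∑ w, (G.dist v w : ℝ)) * ∑ a ∈ Quack.subopt ν, Quack.gap ν a) := by
  refine ⟨6 * 8 ^ ((1 + ε) / ε) + 2, by positivity, ?_⟩
  intro Ω _ P _ m k n hmn G hG v σ ν _ hint hmom X U hXU π hπm hπ
  -- Here `m * n ≥ 2` is essential: it lets the logarithm absorb additive constants.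
  have hlog : 1 ≤ 2 * Real.log ((m : ℝ) * n) := by
    have h1 : (2 : ℝ) ≤ (m : ℝ) * n := by exact_mod_cast hmn
    have h2 := Real.log_le_log (by norm_num) h1
    have h3 := Real.log_two_gt_d9
    linarith
  rw [Finset.mul_sum, ← Finset.sum_add_distrib, Finset.mul_sum, Quack.groupRegret,
    ← Finset.sum_subset (Finset.subset_univ (Quack.subopt ν))]
  · refine Finset.sum_le_sum fun a ha => ?_
    have hgap := Quack.mem_subopt.1 ha
    -- The sign of `σ` is not assumed; a suboptimal action forces it to be positive.
    have hσ := Quack.pos_of_gap_pos hε hint hmom hgap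
    have h := Quack.integral_plays_le (v := v) hXU hG hπm hπ hε hε1 hσ hint hmom
      (show 1 ≤ m * n by omega) hgap
    rw [Nat.cast_mul] at h
    exact (mul_le_mul_of_nonneg_left h hgap.le).trans (Quack.gap_mul_le hε hσ hgap
      (Quack.gap_le_moment hε hσ hint hmom a) hlog
      (Finset.sum_nonneg fun w _ => Nat.cast_nonneg _))
  · intro a _ ha
    rw [Quack.mem_subopt, not_lt] at ha
    rw [le_antisymm ha (Quack.gap_nonneg ν a), zero_mul]
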